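/- **Proposition (RE, Gaussian case).** There is a universal constant $c>0$ such that the following holds. Let $p\ge 2$, $q\ge 0$, $T\ge 0$ be integers and let $(X_t,Y_t)_{t\ge 1}$ be a strictly stationary, centered Gaussian process with $X_t\in\mathbb R^p$, $Y_t\in\mathbb R^q$. Its $\alpha$-mixing coefficients are $$\alpha(l)=\sup_{t\ge 1}\ \sup\bigl\{|P(A\cap B)-P(A)P(B)| : A\in\sigma\bigl((X_s,Y_s): s\le t\bigr),\ B\in\sigma\bigl((X_s,Y_s): s\ge t+l\bigr)\bigr\},\qquad l\ge 0,$$ and the process is assumed to be $\alpha$-mixing, i.e. $\alpha(l)\to 0$ as $l\to\infty$. Put $S_\alpha(T)=\sum_{l=0}^{T}\alpha(l)$, $\Sigma_X=\mathbb E[X_tX_t']$, $\hat\Gamma=\frac1T\sum_{t=1}^{T}X_tX_t'$, and, writing $\lambda_{\min},\lambda_{\max}$ for the smallest and largest eigenvalue of a symmetric matrix, $$\eta=\frac{\lambda_{\min}(\Sigma_X)}{108\pi\, S_\alpha(T)\,\lambda_{\max}(\Sigma_X)},\qquad a=\tfrac12\lambda_{\min}(\Sigma_X),\qquad \tau=\frac{a}{\bigl\lceil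 c\,\frac{T}{4\log p}\,\min\{1,\eta^2\}\bigr\rceil}.$$ If $$T\ \ge\ \frac{42\,e\,\log p}{c\,\min\{1,\eta^2\}},$$ then with probability at least $1-2\exp\bigl(-\tfrac c2\,T\min\{1,\eta^2\}\bigr)$ the matrix $\hat\Gamma$ satisfies the lower restricted eigenvalue condition with curvature $a>0$ and tolerance $\tau>0$, that is, $$v'\hat\Gamma v\ \ge\ a\|v\|_2^2-\tau\|v\|_1^2\quad\text{for all } v\in\mathbb R^p,$$ and moreover $|v'\hat\Gamma v|> a\|v\|_2^2-\tau\|v\|_1^2$ for all $v\ne 0$. (Only the case $\lambda_{\min}(\Sigma_X)>0$ has content; if $\lambda_{\min}(\Sigma_X)=0$ we read $\eta=0$, and the lower bound on the probability is then negative.) -/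

import Mathlib

open MeasureTheory ProbabilityTheory Filter Topology
open scoped Matrix

noncomputable section

namespace GaussRE

/-- The strong (Rosenblatt) dependence measure of two σ-algebras:
`sup { |P(A ∩ B) - P(A) P(B)| : A ∈ m₁, B ∈ m₂ }`. -/
def alphaDep {Ω : Type*} [MeasurableSpace Ω] (μ : Measure Ω) (m₁ m₂ : MeasurableSpace Ω) : ℝ :=
  sSup {r : ℝ | ∃ A B : Set Ω, MeasurableSet[m₁] A ∧ MeasurableSet[m₂] B ∧
    r = |μ.real (A ∩ B) - μ.real A * μ.real B|}

/-- The past `σ(Z_s : s ≤ t)` of a process. -/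
abbrev pastSigma {Ω E : Type*} [MeasurableSpace E] (Z : ℕ → Ω → E) (t : ℕ) : MeasurableSpace Ω :=
  ⨆ s : {s : ℕ // s ≤ t}, MeasurableSpace.comap (Z s) inferInstance

/-- The future `σ(Z_s : s ≥ t)` of a process. -/
abbrev futureSigma {Ω E : Type*} [MeasurableSpace E] (Z : ℕ → Ω → E) (t : ℕ) : MeasurableSpace Ω :=
  ⨆ s : {s : ℕ // t ≤ s}, MeasurableSpace.comap (Z s) inferInstance

/-- The `l`-th α-mixing coefficient of a process: the dependence between the past up to time `t`
and the future from time `t + l`. For a one-sided process the past starts at the initial time,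
hence the supremum over `t`. The same formula is used at `l = 0`. -/
def alphaCoef {Ω E : Type*} [MeasurableSpace Ω] [MeasurableSpace E] (μ : Measure Ω)
    (Z : ℕ → Ω → E) (l : ℕ) : ℝ :=
  ⨆ t : ℕ, alphaDep μ (pastSigma Z t) (futureSigma Z (t + l))

/-- A process is α-mixing if its α-mixing coefficients tend to zero. -/
def IsAlphaMixing {Ω E : Type*} [MeasurableSpace Ω] [MeasurableSpace E] (μ : Measure Ω)
    (Z : ℕ → Ω → E) : Prop :=
  Tendsto (alphaCoef μ Z) atTop (𝓝 0)

/-- `S_α(T) = ∑_{l=0}^T α(l)`. -/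
def alphaSum {Ω E : Type*} [MeasurableSpace Ω] [MeasurableSpace E] (μ : Measure Ω)
    (Z : ℕ → Ω → E) (T : ℕ) : ℝ :=
  ∑ l ∈ Finset.range (T + 1), alphaCoef μ Z l

/-- Strict stationarity: `(Z_m, …, Z_{m+n})` and `(Z_{m+τ}, …, Z_{m+n+τ})` have the same law. -/
def IsStrictlyStationary {Ω E : Type*} [MeasurableSpace Ω] [MeasurableSpace E] (μ : Measure Ω)
    (Z : ℕ → Ω → E) : Prop :=
  ∀ m τ n : ℕ, IdentDistrib (fun ω (i : Fin (n + 1)) => Z (m + i) ω)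
    (fun ω (i : Fin (n + 1)) => Z (m + i + τ) ω) μ μ

/-- The covariance matrix `Σ_X = E[X_t X_t']` of a centered stationary process, taken at the
initial time. -/
def covMatrix {Ω : Type*} [MeasurableSpace Ω] {p : ℕ} (μ : Measure Ω)
    (X : ℕ → Ω → EuclideanSpace ℝ (Fin p)) : Matrix (Fin p) (Fin p) ℝ :=
  Matrix.of fun i j => ∫ ω, X 0 ω i * X 0 ω j ∂μ

/-- The design matrix, whose rows are the first `T` observations. -/
def designMatrix {Ω : Type*} {p : ℕ} (X : ℕ → Ω → EuclideanSpace ℝ (Fin p)) (T : ℕ) (ω : Ω) :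
    Matrix (Fin T) (Fin p) ℝ :=
  Matrix.of fun t i => X t ω i

/-- The empirical covariance matrix `𝐗'𝐗 / T`. -/
def sampleCov {Ω : Type*} {p : ℕ} (X : ℕ → Ω → EuclideanSpace ℝ (Fin p)) (T : ℕ) (ω : Ω) :
    Matrix (Fin p) (Fin p) ℝ :=
  (T : ℝ)⁻¹ • ((designMatrix X T ω)ᵀ * designMatrix X T ω)

/-- Smallest eigenvalue of a symmetric matrix. -/
def lambdaMin {p : ℕ} (M : Matrix (Fin p) (Fin p) ℝ) : ℝ := sInf (spectrum ℝ M)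

/-- Largest eigenvalue of a symmetric matrix. -/
def lambdaMax {p : ℕ} (M : Matrix (Fin p) (Fin p) ℝ) : ℝ := sSup (spectrum ℝ M)

/-- The quadratic form `v' Γ v`. -/
def quadForm {p : ℕ} (Γ : Matrix (Fin p) (Fin p) ℝ) (v : EuclideanSpace ℝ (Fin p)) : ℝ :=
  ∑ i, ∑ j, v i * Γ i j * v j

/-- The `ℓ₁` norm of a vector. -/
def l1norm {p : ℕ} (v : EuclideanSpace ℝ (Fin p)) : ℝ := ∑ i, |v i|

/-- The lower restricted eigenvalue condition for a symmetric matrix, with curvature `a > 0` and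
tolerance `τ > 0`. -/
structure LowerRE {p : ℕ} (Γ : Matrix (Fin p) (Fin p) ℝ) (a τ : ℝ) : Prop where
  symm : Γ.IsSymm
  curvature_pos : 0 < a
  tolerance_pos : 0 < τ
  bound : ∀ v : EuclideanSpace ℝ (Fin p), a * ‖v‖ ^ 2 - τ * l1norm v ^ 2 ≤ quadForm Γ v

end GaussRE

end

namespace GaussRE

/-! The argument joins relative concentration in fixed directions to a sparsification of the ℓ₁
ball.

Fix a direction `u`, with `v = u'Σu > 0`. The scalars `u'X_t` are centered, jointly Gaussian and of
common variance `v`. For a unit-variance Gaussian pair with correlation `r`, `E[sin U sin V] = e⁻¹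
sinh r`. Since the sine is bounded, the covariance inequality for strong mixing gives `|r| ≤ |sinh
r| ≤ 4e α`. Hence the covariance matrix of `(u'X_t)_{t < T}` has absolute row sums at most `8e
S_α(T) v`. These bound its eigenvalues, and Chernoff's method in an eigenbasis shows that `u'Γ̂u` is
within `v/4` of `v` except with probability `2 exp(-T / (2048 e S_α(T)))`. The deviation is relative
to `v`, so the exponent does not depend on the conditioning of `Σ`.

A union bound gives this for all `(2p)^m` sums of `m` signed coordinate vectors. Maurey's argument
extends it to every `v`: with `D = Γ̂ - (3/4)Σ` and `x = v / ‖v‖₁` a convex combination of signed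
coordinate vectors, some `m`-fold sum has `D`-form at most `m² D(x) + m (λ_max/2 - D(x))`. It is
nonnegative by concentration, so `D(x) ≥ -λ_max / (2(m - 1))`. Taking `m - 1 ≥ s λ_max/λ_min`, with
`s` the ceiling in the definition of `τ`, makes the loss at most `τ ‖v‖₁²`
(`quadForm_lower_bound_of_signedSum`). The remaining task, `entropy_le`, is to see that `η²` is
small enough for the concentration exponent to pay for `m log(2p)`. -/

/-! ### Covariance inequality for strong mixing -/

lemma integral_mul_le_of_setIntegral_le {Ω : Type*} {m m0 : MeasurableSpace Ω} {μ : Measure Ω}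
    [IsProbabilityMeasure μ] (hm : m ≤ m0) {f Z : Ω → ℝ} {K : ℝ}
    (hf : Measurable[m] f) (hf0 : ∀ ω, 0 ≤ f ω) (hf1 : ∀ ω, f ω ≤ 1) (hZ : Integrable Z μ)
    (h : ∀ A, MeasurableSet[m] A → ∫ ω in A, Z ω ∂μ ≤ K) :
    ∫ ω, f ω * Z ω ∂μ ≤ K := by
  have hfZ : Integrable (f * Z) μ :=
    hZ.bdd_mul (hf.mono hm le_rfl).aestronglyMeasurable (c := 1)
      (ae_of_all _ fun ω => by rw [Real.norm_of_nonneg (hf0 ω)]; exact hf1 ω)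
  have hA : MeasurableSet[m] {ω | 0 < (μ[Z|m]) ω} :=
    (stronglyMeasurable_condExp (μ := μ) (m := m) (f := Z)).measurable measurableSet_Ioi
  have h1 : ∫ ω, f ω * Z ω ∂μ = ∫ ω, f ω * (μ[Z|m]) ω ∂μ := by
    have := condExp_mul_of_stronglyMeasurable_left (μ := μ) (m := m) hf.stronglyMeasurable hfZ hZ
    calc ∫ ω, f ω * Z ω ∂μ = ∫ ω, (μ[f * Z|m]) ω ∂μ := (integral_condExp hm).symm
      _ = _ := integral_congr_ae this
  have hfC : Integrable (fun ω => f ω * (μ[Z|m]) ω) μ :=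
    integrable_condExp.bdd_mul (hf.mono hm le_rfl).aestronglyMeasurable (c := 1)
      (ae_of_all _ fun ω => by rw [Real.norm_of_nonneg (hf0 ω)]; exact hf1 ω)
  calc ∫ ω, f ω * Z ω ∂μ = ∫ ω, f ω * (μ[Z|m]) ω ∂μ := h1
    -- A linear functional of `f` over `0 ≤ f ≤ 1` is maximized by an indicator, here that of the
    -- set where the conditional expectation is positive.
    _ ≤ ∫ ω, {ω | 0 < (μ[Z|m]) ω}.indicator (μ[Z|m]) ω ∂μ := by
        refine integral_mono hfC (integrable_condExp.indicator (hm _ hA)) fun ω => ?_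
        by_cases hω : 0 < (μ[Z|m]) ω
        · rw [Set.indicator_of_mem (by exact hω)]
          exact mul_le_of_le_one_left hω.le (hf1 ω)
        · rw [Set.indicator_of_notMem (by exact hω)]
          exact mul_nonpos_of_nonneg_of_nonpos (hf0 ω) (not_lt.mp hω)
    _ = ∫ ω in {ω | 0 < (μ[Z|m]) ω}, (μ[Z|m]) ω ∂μ := integral_indicator (hm _ hA)
    _ = ∫ ω in {ω | 0 < (μ[Z|m]) ω}, Z ω ∂μ := setIntegral_condExp hm hZ hA
    _ ≤ K := h _ hA

lemma abs_integral_mul_le_of_abs_setIntegral_le {Ω : Type*} {m m0 : MeasurableSpace Ω}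
    {μ : Measure Ω} [IsProbabilityMeasure μ] (hm : m ≤ m0) {f Z : Ω → ℝ} {K : ℝ}
    (hf : Measurable[m] f) (hf0 : ∀ ω, 0 ≤ f ω) (hf1 : ∀ ω, f ω ≤ 1) (hZ : Integrable Z μ)
    (h : ∀ A, MeasurableSet[m] A → |∫ ω in A, Z ω ∂μ| ≤ K) :
    |∫ ω, f ω * Z ω ∂μ| ≤ K := by
  refine abs_le.mpr ⟨?_, integral_mul_le_of_setIntegral_le hm hf hf0 hf1 hZ
    fun A hA => (le_abs_self _).trans (h A hA)⟩
  have := integral_mul_le_of_setIntegral_le hm hf hf0 hf1 hZ.neg (K := K) fun A hA => by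
    simp only [Pi.neg_apply, integral_neg]
    exact (neg_le_abs _).trans (h A hA)
  simp only [Pi.neg_apply, mul_neg, integral_neg] at this
  linarith

/-- Boundedness is needed for the real suprema defining the mixing coefficients to be genuine ones
rather than the default value `0`. -/
lemma alphaDep_set_bound {Ω : Type*} [MeasurableSpace Ω] (μ : Measure Ω) [IsProbabilityMeasure μ]
    (A B : Set Ω) : |μ.real (A ∩ B) - μ.real A * μ.real B| ≤ 1 := by
  have h1 := measureReal_nonneg (μ := μ) (s := A ∩ B)
  have h2 := measureReal_le_one (μ := μ) (s := A ∩ B)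
  have h3 : 0 ≤ μ.real A * μ.real B := by positivity
  have h4 : μ.real A * μ.real B ≤ 1 :=
    mul_le_one₀ measureReal_le_one measureReal_nonneg measureReal_le_one
  rw [abs_le]; constructor <;> linarith

lemma abs_measureReal_inter_sub_le_alphaDep {Ω : Type*} {m₁ m₂ : MeasurableSpace Ω}
    [MeasurableSpace Ω] (μ : Measure Ω) [IsProbabilityMeasure μ] {A B : Set Ω}
    (hA : MeasurableSet[m₁] A) (hB : MeasurableSet[m₂] B) :
    |μ.real (A ∩ B) - μ.real A * μ.real B| ≤ alphaDep μ m₁ m₂ := by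
  refine le_csSup ⟨1, ?_⟩ ⟨A, B, hA, hB, rfl⟩
  rintro _ ⟨A, B, -, -, rfl⟩
  exact alphaDep_set_bound μ A B

lemma alphaDep_nonneg {Ω : Type*} (m₁ m₂ : MeasurableSpace Ω) [MeasurableSpace Ω] (μ : Measure Ω)
    [IsProbabilityMeasure μ] : 0 ≤ alphaDep μ m₁ m₂ :=
  (abs_nonneg _).trans (abs_measureReal_inter_sub_le_alphaDep μ
    (@MeasurableSet.empty _ m₁) (@MeasurableSet.empty _ m₂))

lemma alphaDep_le_one {Ω : Type*} (m₁ m₂ : MeasurableSpace Ω) [MeasurableSpace Ω] (μ : Measure Ω)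
    [IsProbabilityMeasure μ] : alphaDep μ m₁ m₂ ≤ 1 := by
  refine csSup_le ⟨_, ∅, ∅, @MeasurableSet.empty _ m₁, @MeasurableSet.empty _ m₂, rfl⟩ ?_
  rintro _ ⟨A, B, -, -, rfl⟩
  exact alphaDep_set_bound μ A B

lemma alphaDep_le_alphaCoef {Ω E : Type*} [MeasurableSpace Ω] [MeasurableSpace E] (μ : Measure Ω)
    [IsProbabilityMeasure μ] (Z : ℕ → Ω → E) (t l : ℕ) :
    alphaDep μ (pastSigma Z t) (futureSigma Z (t + l)) ≤ alphaCoef μ Z l :=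
  le_ciSup (f := fun t => alphaDep μ (pastSigma Z t) (futureSigma Z (t + l)))
    ⟨1, by rintro _ ⟨t, rfl⟩; exact alphaDep_le_one _ _ _⟩ t

lemma alphaCoef_nonneg {Ω E : Type*} [MeasurableSpace Ω] [MeasurableSpace E] (μ : Measure Ω)
    [IsProbabilityMeasure μ] (Z : ℕ → Ω → E) (l : ℕ) : 0 ≤ alphaCoef μ Z l :=
  (alphaDep_nonneg _ _ μ).trans (alphaDep_le_alphaCoef μ Z 0 l)

/-- Ibragimov's covariance inequality for `[0, 1]`-valued functions. -/
lemma abs_cov_le_alphaDep {Ω : Type*} {m₁ m₂ : MeasurableSpace Ω} [m0 : MeasurableSpace Ω]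
    (μ : Measure Ω) [IsProbabilityMeasure μ] (hm₁ : m₁ ≤ m0) (hm₂ : m₂ ≤ m0)
    {f g : Ω → ℝ} (hf : Measurable[m₁] f) (hf0 : ∀ ω, 0 ≤ f ω) (hf1 : ∀ ω, f ω ≤ 1)
    (hg : Measurable[m₂] g) (hg0 : ∀ ω, 0 ≤ g ω) (hg1 : ∀ ω, g ω ≤ 1) :
    |∫ ω, f ω * g ω ∂μ - (∫ ω, f ω ∂μ) * ∫ ω, g ω ∂μ| ≤ alphaDep μ m₁ m₂ := by
  have hgi : Integrable g μ := Integrable.of_bound (hg.mono hm₂ le_rfl).aestronglyMeasurable 1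
    (ae_of_all _ fun ω => by rw [Real.norm_of_nonneg (hg0 ω)]; exact hg1 ω)
  have hfi : Integrable f μ := Integrable.of_bound (hf.mono hm₁ le_rfl).aestronglyMeasurable 1
    (ae_of_all _ fun ω => by rw [Real.norm_of_nonneg (hf0 ω)]; exact hf1 ω)
  have hfg : Integrable (fun ω => f ω * g ω) μ :=
    hgi.bdd_mul (hf.mono hm₁ le_rfl).aestronglyMeasurable (c := 1)
      (ae_of_all _ fun ω => by rw [Real.norm_of_nonneg (hf0 ω)]; exact hf1 ω)
  -- The covariance is bilinear, so indicators replace the functions one at a time: `f` by `1_A`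
  -- here, then `g` by `1_B`.
  have key := abs_integral_mul_le_of_abs_setIntegral_le hm₁ hf hf0 hf1
    (Z := fun ω => g ω - ∫ ω, g ω ∂μ) (K := alphaDep μ m₁ m₂) (hgi.sub (integrable_const _)) ?_
  · have e : ∀ ω, f ω * (g ω - ∫ ω, g ω ∂μ) = f ω * g ω - f ω * ∫ ω, g ω ∂μ := fun ω => by ring
    simp only [e] at key
    rwa [integral_sub hfg (hfi.mul_const _), integral_mul_const] at key
  intro A hA
  have hAi : Integrable (A.indicator (1 : Ω → ℝ)) μ := (integrable_const 1).indicator (hm₁ _ hA)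
  have key2 := abs_integral_mul_le_of_abs_setIntegral_le hm₂ hg hg0 hg1
    (Z := fun ω => A.indicator (1 : Ω → ℝ) ω - μ.real A) (K := alphaDep μ m₁ m₂)
    (hAi.sub (integrable_const _)) ?_
  · have e : ∀ ω, g ω * (A.indicator (1 : Ω → ℝ) ω - μ.real A)
        = A.indicator g ω - g ω * μ.real A := fun ω => by
      by_cases h : ω ∈ A <;> simp [h]; ring
    simp only [e] at key2
    rw [integral_sub (hgi.indicator (hm₁ _ hA)) (hgi.mul_const _), integral_mul_const,
      integral_indicator (hm₁ _ hA)] at key2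
    rw [integral_sub hgi.integrableOn (integrable_const _).integrableOn, setIntegral_const]
    rwa [smul_eq_mul, mul_comm]
  intro B hB
  rw [integral_sub hAi.integrableOn (integrable_const _).integrableOn, setIntegral_const,
    setIntegral_indicator (hm₁ _ hA)]
  simp only [Pi.one_apply, setIntegral_const, smul_eq_mul, mul_one]
  rw [Set.inter_comm, mul_comm]
  exact abs_measureReal_inter_sub_le_alphaDep μ hA hB

/-! ### Correlation of Gaussian pairs under strong mixing -/

lemma integral_cexp_mul_I_of_hasGaussianLaw {Ω : Type*} [MeasurableSpace Ω] {μ : Measure Ω}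
    {Y : Ω → ℝ} (hY : HasGaussianLaw Y μ) (h0 : ∫ ω, Y ω ∂μ = 0) :
    ∫ ω, Complex.exp (Y ω * Complex.I) ∂μ = Real.exp (-(∫ ω, Y ω ^ 2 ∂μ) / 2) := by
  have h1 := hY.charFun_map_eq 1
  rw [charFun_apply_real, integral_map hY.aemeasurable (by fun_prop)] at h1
  have hv : Var[Y; μ] = ∫ ω, Y ω ^ 2 ∂μ := variance_of_integral_eq_zero hY.aemeasurable h0
  simp only [Complex.ofReal_one, one_mul] at h1
  rw [h1]
  simp [h0, hv, neg_div]

lemma integral_cos_sin_of_hasGaussianLaw {Ω : Type*} [MeasurableSpace Ω] {μ : Measure Ω}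
    {Y : Ω → ℝ} (hY : HasGaussianLaw Y μ) (h0 : ∫ ω, Y ω ∂μ = 0) :
    ∫ ω, Real.cos (Y ω) ∂μ = Real.exp (-(∫ ω, Y ω ^ 2 ∂μ) / 2) ∧ ∫ ω, Real.sin (Y ω) ∂μ = 0 := by
  have := hY.isProbabilityMeasure
  have h := integral_cexp_mul_I_of_hasGaussianLaw hY h0
  have hi : Integrable (fun ω => Complex.exp (Y ω * Complex.I)) μ := by
    have := hY.aemeasurable
    refine Integrable.of_bound (by fun_prop) 1 (ae_of_all _ fun ω => ?_)
    rw [Complex.norm_exp_ofReal_mul_I]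
  constructor
  · have := congrArg Complex.re h
    rw [Complex.ofReal_re] at this
    rw [← this, ← RCLike.re_eq_complex_re, ← integral_re hi]
    simp [Complex.exp_ofReal_mul_I_re]
  · have := congrArg Complex.im h
    rw [Complex.ofReal_im] at this
    rw [← this, ← RCLike.im_eq_complex_im, ← integral_im hi]
    simp [Complex.exp_ofReal_mul_I_im]

lemma abs_le_abs_sinh (r : ℝ) : |r| ≤ |Real.sinh r| := by
  rw [Real.abs_sinh]
  exact Real.self_le_sinh_iff.mpr (abs_nonneg r)

/-- The correlation of a Gaussian pair is controlled by its strong mixing coefficient. -/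
lemma abs_integral_mul_le_alphaDep_of_unit {Ω : Type*} {m₁ m₂ : MeasurableSpace Ω}
    [m0 : MeasurableSpace Ω]
    {μ : Measure Ω} [IsProbabilityMeasure μ] (hm₁ : m₁ ≤ m0) (hm₂ : m₂ ≤ m0)
    {U V : Ω → ℝ} (hUm : Measurable[m₁] U) (hVm : Measurable[m₂] V)
    (hG : HasGaussianLaw (fun ω => (U ω, V ω)) μ)
    (hU0 : ∫ ω, U ω ∂μ = 0) (hV0 : ∫ ω, V ω ∂μ = 0)
    (hU1 : ∫ ω, U ω ^ 2 ∂μ = 1) (hV1 : ∫ ω, V ω ^ 2 ∂μ = 1) :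
    |∫ ω, U ω * V ω ∂μ| ≤ 4 * Real.exp 1 * alphaDep μ m₁ m₂ := by
  set r := ∫ ω, U ω * V ω ∂μ with hr
  have hUi := hG.fst.integrable
  have hVi := hG.snd.integrable
  have hU2 := hG.fst.memLp_two
  have hV2 := hG.snd.memLp_two
  have hUV : Integrable (fun ω => U ω * V ω) μ := hU2.integrable_mul hV2
  have hUU : Integrable (fun ω => U ω ^ 2) μ := hU2.integrable_sq
  have hVV : Integrable (fun ω => V ω ^ 2) μ := hV2.integrable_sq
  have hsum : Integrable (fun ω => U ω ^ 2 + V ω ^ 2) μ := hUU.add hVV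
  have hUm' := hUm.mono hm₁ le_rfl
  have hVm' := hVm.mono hm₂ le_rfl
  have hadd : ∫ ω, Real.cos (U ω + V ω) ∂μ = Real.exp (-1 - r) := by
    rw [(integral_cos_sin_of_hasGaussianLaw hG.fun_add
      (by rw [integral_add hUi hVi, hU0, hV0, add_zero])).1]
    congr 1
    have e : ∀ ω, (U ω + V ω) ^ 2 = U ω ^ 2 + V ω ^ 2 + 2 * (U ω * V ω) := fun ω => by ring
    simp only [e]
    rw [integral_add hsum (hUV.const_mul 2), integral_add hUU hVV, integral_const_mul,
      hU1, hV1, ← hr]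
    ring
  have hsub : ∫ ω, Real.cos (U ω - V ω) ∂μ = Real.exp (-1 + r) := by
    rw [(integral_cos_sin_of_hasGaussianLaw hG.fun_sub
      (by rw [integral_sub hUi hVi, hU0, hV0, sub_zero])).1]
    congr 1
    have e : ∀ ω, (U ω - V ω) ^ 2 = U ω ^ 2 + V ω ^ 2 - 2 * (U ω * V ω) := fun ω => by ring
    simp only [e]
    rw [integral_sub hsum (hUV.const_mul 2), integral_add hUU hVV, integral_const_mul,
      hU1, hV1, ← hr]
    ring
  have hbd : ∀ F : Ω → ℝ, Measurable F → (∀ ω, |F ω| ≤ 1) → Integrable F μ := fun F hF hb =>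
    Integrable.of_bound hF.aestronglyMeasurable 1 (ae_of_all _ hb)
  have hsin : ∫ ω, Real.sin (U ω) * Real.sin (V ω) ∂μ = Real.exp (-1) * Real.sinh r := by
    have e : ∀ ω, Real.sin (U ω) * Real.sin (V ω)
        = (Real.cos (U ω - V ω) - Real.cos (U ω + V ω)) / 2 := fun ω => by
      rw [Real.cos_sub, Real.cos_add]; ring
    simp only [e]
    rw [integral_div, integral_sub (hbd _ (by fun_prop) fun ω => Real.abs_cos_le_one _)
      (hbd _ (by fun_prop) fun ω => Real.abs_cos_le_one _), hadd, hsub, Real.sinh_eq,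
      Real.exp_add, sub_eq_add_neg (-1 : ℝ) r, Real.exp_add]
    ring
  have hsU : Integrable (fun ω => Real.sin (U ω)) μ :=
    hbd _ (by fun_prop) fun ω => Real.abs_sin_le_one _
  have hsV : Integrable (fun ω => Real.sin (V ω)) μ :=
    hbd _ (by fun_prop) fun ω => Real.abs_sin_le_one _
  have hsU1 : Integrable (fun ω => 1 + Real.sin (U ω)) μ := (integrable_const _).add hsU
  have hsU2 : Integrable (fun ω => 1 + Real.sin (U ω) + Real.sin (V ω)) μ := hsU1.add hsV
  have hsUV : Integrable (fun ω => Real.sin (U ω) * Real.sin (V ω)) μ :=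
    hbd _ (by fun_prop) fun ω => by
      rw [abs_mul]
      exact mul_le_one₀ (Real.abs_sin_le_one _) (abs_nonneg _) (Real.abs_sin_le_one _)
  have hlo : ∀ x : ℝ, 0 ≤ (1 + Real.sin x) / 2 := fun x => by linarith [Real.neg_one_le_sin x]
  have hhi : ∀ x : ℝ, (1 + Real.sin x) / 2 ≤ 1 := fun x => by linarith [Real.sin_le_one x]
  have hms : Measurable fun x : ℝ => (1 + Real.sin x) / 2 := by fun_prop
  -- Rescaling the sine to take values in `[0, 1]` divides the covariance by `4`, the source of the
  -- factor `4` in the bound.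
  have hcov := abs_cov_le_alphaDep μ hm₁ hm₂ (f := fun ω => (1 + Real.sin (U ω)) / 2)
    (g := fun ω => (1 + Real.sin (V ω)) / 2) (hms.comp hUm) (fun _ => hlo _) (fun _ => hhi _)
    (hms.comp hVm) (fun _ => hlo _) (fun _ => hhi _)
  have hfU : ∫ ω, (1 + Real.sin (U ω)) / 2 ∂μ = 1 / 2 := by
    rw [integral_div, integral_add (integrable_const _) hsU,
      (integral_cos_sin_of_hasGaussianLaw hG.fst hU0).2]
    simp
  have hfV : ∫ ω, (1 + Real.sin (V ω)) / 2 ∂μ = 1 / 2 := by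
    rw [integral_div, integral_add (integrable_const _) hsV,
      (integral_cos_sin_of_hasGaussianLaw hG.snd hV0).2]
    simp
  have hprod : ∫ ω, (1 + Real.sin (U ω)) / 2 * ((1 + Real.sin (V ω)) / 2) ∂μ
      = 1 / 4 + Real.exp (-1) * Real.sinh r / 4 := by
    have e : ∀ ω, (1 + Real.sin (U ω)) / 2 * ((1 + Real.sin (V ω)) / 2)
        = (1 + Real.sin (U ω) + Real.sin (V ω) + Real.sin (U ω) * Real.sin (V ω)) / 4 :=
      fun ω => by ring
    simp only [e]
    rw [integral_div, integral_add hsU2 hsUV,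
      integral_add hsU1 hsV, integral_add (integrable_const _) hsU,
      (integral_cos_sin_of_hasGaussianLaw hG.fst hU0).2,
      (integral_cos_sin_of_hasGaussianLaw hG.snd hV0).2, hsin]
    simp
    ring
  rw [hprod, hfU, hfV] at hcov
  have e2 : 1 / 4 + Real.exp (-1) * Real.sinh r / 4 - 1 / 2 * (1 / 2)
      = (Real.exp 1)⁻¹ / 4 * Real.sinh r := by rw [Real.exp_neg]; ring
  rw [e2, abs_mul, abs_of_pos (by positivity)] at hcov
  refine (abs_le_abs_sinh r).trans ?_
  have h3 := mul_le_mul_of_nonneg_left hcov (by positivity : (0 : ℝ) ≤ 4 * Real.exp 1)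
  calc |Real.sinh r| = 4 * Real.exp 1 * ((Real.exp 1)⁻¹ / 4 * |Real.sinh r|) := by
        field_simp
    _ ≤ _ := h3

lemma abs_integral_mul_le_alphaDep {Ω : Type*} {m₁ m₂ : MeasurableSpace Ω} [m0 : MeasurableSpace Ω]
    {μ : Measure Ω} [IsProbabilityMeasure μ] (hm₁ : m₁ ≤ m0) (hm₂ : m₂ ≤ m0)
    {U V : Ω → ℝ} (hUm : Measurable[m₁] U) (hVm : Measurable[m₂] V)
    (hG : HasGaussianLaw (fun ω => (U ω, V ω)) μ)
    (hU0 : ∫ ω, U ω ∂μ = 0) (hV0 : ∫ ω, V ω ∂μ = 0) {s : ℝ} (hs : 0 < s)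
    (hU1 : ∫ ω, U ω ^ 2 ∂μ = s) (hV1 : ∫ ω, V ω ^ 2 ∂μ = s) :
    |∫ ω, U ω * V ω ∂μ| ≤ 4 * Real.exp 1 * alphaDep μ m₁ m₂ * s := by
  have hss : (√s)⁻¹ ^ 2 = s⁻¹ := by rw [inv_pow, Real.sq_sqrt hs.le]
  have h := abs_integral_mul_le_alphaDep_of_unit hm₁ hm₂ (U := fun ω => (√s)⁻¹ * U ω)
    (V := fun ω => (√s)⁻¹ * V ω) (hUm.const_mul _) (hVm.const_mul _)
    (hG.fun_smul (√s)⁻¹) (by rw [integral_const_mul, hU0, mul_zero])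
    (by rw [integral_const_mul, hV0, mul_zero])
    (by simp only [mul_pow]; rw [integral_const_mul, hU1, hss, inv_mul_cancel₀ hs.ne'])
    (by simp only [mul_pow]; rw [integral_const_mul, hV1, hss, inv_mul_cancel₀ hs.ne'])
  have e : ∀ ω, (√s)⁻¹ * U ω * ((√s)⁻¹ * V ω) = s⁻¹ * (U ω * V ω) := fun ω => by
    rw [← hss]; ring
  simp only [e] at h
  rw [integral_const_mul, abs_mul, abs_of_pos (inv_pos.mpr hs), inv_mul_le_iff₀ hs] at h
  linarith

/-! ### Concentration of Gaussian quadratic forms -/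

lemma one_div_one_sub_le_exp {x : ℝ} (hx : |x| ≤ 1 / 2) :
    1 / (1 - x) ≤ Real.exp (x + 2 * x ^ 2) := by
  have h1 : 0 < 1 - x := by linarith [(abs_le.mp hx).2]
  have h := Real.abs_log_sub_add_sum_range_le (x := x) (by linarith) 1
  simp only [Finset.sum_range_one, zero_add, pow_one, CharP.cast_eq_zero, div_one] at h
  have h2 : |x| ^ (1 + 1) / (1 - |x|) ≤ 2 * x ^ 2 := by
    rw [div_le_iff₀ (by linarith), one_add_one_eq_two, sq_abs]
    nlinarith [sq_nonneg x]
  have h3 := neg_le_of_abs_le h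
  rw [one_div, ← Real.exp_log h1, ← Real.exp_neg]
  exact Real.exp_le_exp.mpr (by linarith)

/-- Moment generating function of the square of a centered Gaussian variable. -/
lemma mgf_sq_le_of_hasGaussianLaw {Ω : Type*} [MeasurableSpace Ω] {μ : Measure Ω}
    {Y : Ω → ℝ} (hY : HasGaussianLaw Y μ) (h0 : ∫ ω, Y ω ∂μ = 0) {q l : ℝ}
    (hq : ∫ ω, Y ω ^ 2 ∂μ = q) (hl : |l| * q ≤ 1 / 4) :
    Integrable (fun ω => Real.exp (l * Y ω ^ 2)) μ ∧
      mgf (fun ω => Y ω ^ 2) μ l ≤ Real.exp (l * q + 4 * l ^ 2 * q ^ 2) := by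
  have hq0 : 0 ≤ q := hq ▸ integral_nonneg fun ω => sq_nonneg _
  have hmap : μ.map Y = gaussianReal 0 q.toNNReal := by
    rw [hY.map_eq_gaussianReal, variance_of_integral_eq_zero hY.aemeasurable h0, hq, h0]
  have hmeas : Measurable fun x : ℝ => Real.exp (l * x ^ 2) := by fun_prop
  have hi : Integrable (fun ω => Real.exp (l * Y ω ^ 2)) μ ↔
      Integrable (fun x => Real.exp (l * x ^ 2)) (gaussianReal 0 q.toNNReal) := by
    rw [← hmap, integrable_map_measure hmeas.aestronglyMeasurable hY.aemeasurable]
    rfl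
  have hm : mgf (fun ω => Y ω ^ 2) μ l
      = ∫ x, Real.exp (l * x ^ 2) ∂gaussianReal 0 q.toNNReal := by
    rw [← hmap, integral_map hY.aemeasurable hmeas.aestronglyMeasurable]
    rfl
  rw [hi, hm]
  rcases hq0.eq_or_lt with rfl | hq0
  -- Zero variance gives a point mass, which has no density and is treated apart.
  · rw [Real.toNNReal_zero, gaussianReal_zero_var]
    simp [integrable_dirac]
  have hqn : q.toNNReal ≠ 0 := (Real.toNNReal_pos.mpr hq0).ne'
  have hqc : (q.toNNReal : ℝ) = q := Real.coe_toNNReal _ hq0.le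
  have hx : |2 * l * q| ≤ 1 / 2 := by
    rw [abs_mul, abs_mul, abs_of_pos hq0, abs_of_pos (two_pos : (0 : ℝ) < 2)]; linarith
  have hx1 : 0 < 1 - 2 * l * q := by linarith [(abs_le.mp hx).2]
  have hb : 0 < 1 / (2 * q) - l := by
    have : 1 / (2 * q) - l = (1 - 2 * l * q) / (2 * q) := by field_simp
    rw [this]; positivity
  have hpdf : ∀ x, gaussianPDFReal 0 q.toNNReal x * Real.exp (l * x ^ 2)
      = (√(2 * Real.pi * q))⁻¹ * Real.exp (-(1 / (2 * q) - l) * x ^ 2) := fun x => by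
    rw [gaussianPDFReal, hqc, mul_assoc, ← Real.exp_add]
    congr 2
    field_simp
    ring
  constructor
  · rw [gaussianReal_of_var_ne_zero _ hqn, integrable_withDensity_iff_integrable_smul'
      (measurable_gaussianPDF _ _) (ae_of_all _ fun _ => gaussianPDF_lt_top)]
    simp only [toReal_gaussianPDF, smul_eq_mul, hpdf]
    exact (integrable_exp_neg_mul_sq hb).const_mul _
  · rw [integral_gaussianReal_eq_integral_smul hqn]
    simp only [smul_eq_mul, hpdf]
    rw [integral_const_mul, integral_gaussian, ← Real.sqrt_inv, ← Real.sqrt_mul (by positivity)]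
    -- The transform is exactly `(1 - 2lq)^(-1/2)`; the bound is the square root of the elementary
    -- inequality at `x = 2lq`.
    have e : (2 * Real.pi * q)⁻¹ * (Real.pi / (1 / (2 * q) - l)) = 1 / (1 - 2 * l * q) := by
      have : 1 / (2 * q) - l = (1 - 2 * l * q) / (2 * q) := by field_simp
      rw [this]
      field_simp
    rw [e, Real.sqrt_le_left (Real.exp_pos _).le, ← Real.exp_nat_mul]
    refine (one_div_one_sub_le_exp hx).trans (Real.exp_le_exp.mpr (le_of_eq ?_))
    push_cast
    ring

/-- A Schur test: the quadratic form of a symmetric kernel is bounded by its row sums. -/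
lemma sum_mul_mul_le_of_row_sum_le {ι : Type*} [Fintype ι] {Q : ι → ι → ℝ}
    (hQ : ∀ i j, Q i j = Q j i) {B : ℝ} (hB : ∀ i, ∑ j, |Q i j| ≤ B) (u : ι → ℝ) :
    ∑ i, ∑ j, u i * u j * Q i j ≤ B * ∑ i, u i ^ 2 := by
  have h1 : ∑ i, ∑ j, u i * u j * Q i j
      ≤ ∑ i, ∑ j, (u i ^ 2 / 2 * |Q i j| + u j ^ 2 / 2 * |Q j i|) := by
    refine Finset.sum_le_sum fun i _ => Finset.sum_le_sum fun j _ => ?_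
    rw [← hQ i j, ← add_mul]
    refine (le_abs_self _).trans ?_
    rw [abs_mul]
    refine mul_le_mul_of_nonneg_right ?_ (abs_nonneg _)
    rw [abs_le]
    constructor <;> nlinarith [sq_nonneg (u i + u j), sq_nonneg (u i - u j)]
  have h2 : ∑ i, ∑ j, (u i ^ 2 / 2 * |Q i j| + u j ^ 2 / 2 * |Q j i|)
      = ∑ i, u i ^ 2 * ∑ j, |Q i j| := by
    simp only [Finset.sum_add_distrib]
    rw [Finset.sum_comm (f := fun i j => u j ^ 2 / 2 * |Q j i|)]
    simp only [← Finset.mul_sum]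
    rw [← Finset.sum_add_distrib]
    exact Finset.sum_congr rfl fun i _ => by ring
  rw [h2] at h1
  refine h1.trans ?_
  rw [Finset.mul_sum]
  exact Finset.sum_le_sum fun i _ => by
    rw [mul_comm]; exact mul_le_mul_of_nonneg_right (hB i) (sq_nonneg _)

/-- Moment generating function of the squared norm of a centered Gaussian vector whose covariance
matrix has absolute row sums at most `B`. -/
lemma mgf_sum_sq_le_of_hasGaussianLaw {Ω ι : Type*} [MeasurableSpace Ω] {μ : Measure Ω}
    [Fintype ι] [IsProbabilityMeasure μ] {z : ι → Ω → ℝ} (hz : ∀ i, Measurable (z i))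
    (hG : HasGaussianLaw (fun ω i => z i ω) μ) (h0 : ∀ i, ∫ ω, z i ω ∂μ = 0) {B l : ℝ}
    (hB : ∀ i, ∑ j, |∫ ω, z i ω * z j ω ∂μ| ≤ B) (hl : |l| * B ≤ 1 / 4) :
    Integrable (fun ω => Real.exp (l * ∑ i, z i ω ^ 2)) μ ∧
      mgf (fun ω => ∑ i, z i ω ^ 2) μ l
        ≤ Real.exp ((l + 4 * l ^ 2 * B) * ∑ i, ∫ ω, z i ω ^ 2 ∂μ) := by
  classical
  set Q : Matrix ι ι ℝ := Matrix.of fun i j => ∫ ω, z i ω * z j ω ∂μ with hQ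
  have hQs : ∀ i j, Q i j = Q j i := fun i j => by simp [hQ, mul_comm]
  have hQH : Q.IsHermitian := Matrix.IsHermitian.ext fun i j => by simp [hQs i j]
  set u := hQH.eigenvectorBasis with hu
  have hz2 : ∀ i, MemLp (z i) 2 μ := fun i => (hG.eval i).memLp_two
  have hzz : ∀ i j, Integrable (fun ω => z i ω * z j ω) μ := fun i j =>
    (hz2 i).integrable_mul (hz2 j)
  have hz1 : ∀ i, Integrable (z i) μ := fun i => (hG.eval i).integrable
  set w : ι → Ω → ℝ := fun k ω => ∑ i, u k i * z i ω with hw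
  have hwG : HasGaussianLaw (fun ω k => w k ω) μ := by
    let L : (ι → ℝ) →L[ℝ] (ι → ℝ) := ContinuousLinearMap.pi fun k =>
      ∑ i, u k i • ContinuousLinearMap.proj i
    have := hG.map_fun L
    refine (funext fun ω => funext fun k => ?_ : (fun ω k => w k ω) = _) ▸ this
    simp [L, w]
  have hwm : ∀ k, Measurable (w k) := fun k => by fun_prop
  have hw0 : ∀ k, ∫ ω, w k ω ∂μ = 0 := fun k => by
    change ∫ ω, ∑ i, u k i * z i ω ∂μ = 0
    rw [integral_finsetSum _ fun i _ => (hz1 i).const_mul _]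
    simp [integral_const_mul, h0]
  have hww : ∀ k m, ∫ ω, w k ω * w m ω ∂μ = ∑ i, ∑ j, u k i * u m j * Q i j := fun k m => by
    have e : ∀ ω, w k ω * w m ω = ∑ i, ∑ j, u k i * u m j * (z i ω * z j ω) := fun ω => by
      simp only [hw]
      rw [Finset.sum_mul_sum]
      exact Finset.sum_congr rfl fun i _ => Finset.sum_congr rfl fun j _ => by ring
    simp only [e]
    rw [integral_finsetSum _ fun i _ => integrable_finsetSum _ fun j _ =>
      (hzz i j).const_mul _]
    refine Finset.sum_congr rfl fun i _ => ?_
    rw [integral_finsetSum _ fun j _ => (hzz i j).const_mul _]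
    exact Finset.sum_congr rfl fun j _ => by rw [integral_const_mul]; rfl
  have hwQ : ∀ k m, k ≠ m → ∫ ω, w k ω * w m ω ∂μ = 0 := fun k m hkm => by
    have h1 : ∀ i, ∑ j, u k i * u m j * Q i j = hQH.eigenvalues m * (u k i * u m i) := fun i => by
      have := congrFun (hQH.mulVec_eigenvectorBasis m) i
      simp only [Matrix.mulVec, dotProduct, Pi.smul_apply, smul_eq_mul] at this
      rw [← hu] at this
      calc ∑ j, u k i * u m j * Q i j = u k i * ∑ j, Q i j * u m j := by
            rw [Finset.mul_sum]; exact Finset.sum_congr rfl fun j _ => by ring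
        _ = _ := by rw [this]; ring
    rw [hww, Finset.sum_congr rfl fun i _ => h1 i, ← Finset.mul_sum]
    have h2 : inner ℝ (u k) (u m) = 0 := u.orthonormal.2 hkm
    rw [PiLp.inner_apply] at h2
    simp only [RCLike.inner_apply, conj_trivial] at h2
    rw [show ∑ i, u k i * u m i = 0 by
      rw [← h2]; exact Finset.sum_congr rfl fun i _ => mul_comm _ _,
      mul_zero]
  -- Coordinates in an eigenbasis of the covariance matrix are uncorrelated and jointly Gaussian,
  -- hence independent.
  have hwi : iIndepFun w μ := hwG.iIndepFun_of_covariance_eq_zero fun k m hkm => by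
    rw [covariance_eq_sub (hwG.eval k).memLp_two (hwG.eval m).memLp_two, hw0 k, zero_mul, sub_zero]
    exact hwQ k m hkm
  have hnorm : ∀ ω, ∑ k, w k ω ^ 2 = ∑ i, z i ω ^ 2 := fun ω => by
    have := u.sum_sq_norm_inner_right (WithLp.toLp 2 fun i => z i ω)
    rw [EuclideanSpace.norm_sq_eq] at this
    simp only [Real.norm_eq_abs, sq_abs, PiLp.inner_apply, RCLike.inner_apply,
      conj_trivial] at this
    rw [← this]
    exact Finset.sum_congr rfl fun k _ => by
      congr 1; exact Finset.sum_congr rfl fun i _ => mul_comm _ _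
  set q : ι → ℝ := fun k => ∫ ω, w k ω ^ 2 ∂μ with hq
  have hq0 : ∀ k, 0 ≤ q k := fun k => integral_nonneg fun ω => sq_nonneg _
  -- Each `q k` is an eigenvalue of `Q`, bounded by the Schur test at a unit eigenvector.
  have hqB : ∀ k, q k ≤ B := fun k => by
    have h1 := sum_mul_mul_le_of_row_sum_le hQs hB (u k)
    have h2 : ∑ i, u k i ^ 2 = 1 := by
      have := EuclideanSpace.norm_sq_eq (u k)
      rw [u.orthonormal.1 k] at this
      simpa using this.symm
    rw [h2, mul_one, ← hww] at h1
    simpa only [hq, sq] using h1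
  have hsum : ∑ k, q k = ∑ i, ∫ ω, z i ω ^ 2 ∂μ := by
    simp only [hq]
    rw [← integral_finsetSum _ fun k _ => (hwG.eval k).memLp_two.integrable_sq,
      ← integral_finsetSum _ fun k _ => (hz2 k).integrable_sq]
    simp only [hnorm]
  have hlq : ∀ k, |l| * q k ≤ 1 / 4 := fun k =>
    (mul_le_mul_of_nonneg_left (hqB k) (abs_nonneg _)).trans hl
  have hk := fun k => mgf_sq_le_of_hasGaussianLaw (hwG.eval k) (hw0 k) rfl (hlq k)
  have hind : iIndepFun (fun k ω => w k ω ^ 2) μ :=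
    hwi.comp (fun _ x => x ^ 2) fun _ => by fun_prop
  have hfun : (fun ω => ∑ i, z i ω ^ 2) = ∑ k, fun ω => w k ω ^ 2 := by
    ext ω; rw [Finset.sum_apply, hnorm]
  constructor
  · have := hind.integrable_exp_mul_sum (s := Finset.univ) (t := l)
      (fun k => (hwm k).pow_const 2) fun k _ => (hk k).1
    rw [← hfun] at this
    exact this
  · rw [hfun, hind.mgf_sum fun k => (hwm k).pow_const 2]
    calc ∏ k, mgf (fun ω => w k ω ^ 2) μ l
        ≤ ∏ k, Real.exp (l * q k + 4 * l ^ 2 * q k ^ 2) :=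
          Finset.prod_le_prod (fun k _ => mgf_nonneg) fun k _ => (hk k).2
      _ = Real.exp (∑ k, (l * q k + 4 * l ^ 2 * q k ^ 2)) := (Real.exp_sum _ _).symm
      _ ≤ _ := by
        rw [Real.exp_le_exp, ← hsum, Finset.mul_sum]
        refine Finset.sum_le_sum fun k _ => ?_
        have : q k ^ 2 ≤ B * q k := by rw [sq]; exact mul_le_mul_of_nonneg_right (hqB k) (hq0 k)
        nlinarith [mul_le_mul_of_nonneg_left this (by positivity : 0 ≤ 4 * l ^ 2)]

/-- Concentration of the squared norm of a centered Gaussian vector whose covariance matrix has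
absolute row sums at most `B`. -/
lemma measureReal_sum_sq_deviation_le {Ω ι : Type*} [MeasurableSpace Ω] {μ : Measure Ω}
    [Fintype ι] [IsProbabilityMeasure μ] {z : ι → Ω → ℝ} (hz : ∀ i, Measurable (z i))
    (hG : HasGaussianLaw (fun ω i => z i ω) μ) (h0 : ∀ i, ∫ ω, z i ω ∂μ = 0) {B M : ℝ}
    (hB0 : 0 < B) (hB : ∀ i, ∑ j, |∫ ω, z i ω * z j ω ∂μ| ≤ B)
    (hM : ∑ i, ∫ ω, z i ω ^ 2 ∂μ = M) :
    μ.real {ω | M / 4 ≤ |∑ i, z i ω ^ 2 - M|} ≤ 2 * Real.exp (-(M / (256 * B))) := by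
  -- The value `l = 1/(32B)` minimizes the Chernoff exponent `-lM/4 + 4l²BM`, with minimum
  -- `-M/(256B)`; the lower tail uses `-l`.
  have hpos : |1 / (32 * B)| * B ≤ 1 / 4 := by
    rw [abs_of_pos (by positivity)]; field_simp; norm_num
  have hneg : |-(1 / (32 * B))| * B ≤ 1 / 4 := by rwa [abs_neg]
  obtain ⟨i1, m1⟩ := mgf_sum_sq_le_of_hasGaussianLaw hz hG h0 hB hpos
  obtain ⟨i2, m2⟩ := mgf_sum_sq_le_of_hasGaussianLaw hz hG h0 hB hneg
  rw [hM] at m1 m2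
  have h1 : μ.real {ω | M + M / 4 ≤ ∑ i, z i ω ^ 2} ≤ Real.exp (-(M / (256 * B))) := by
    refine (measure_ge_le_exp_mul_mgf _ (by positivity) i1).trans
      ((mul_le_mul_of_nonneg_left m1 (Real.exp_pos _).le).trans ?_)
    rw [← Real.exp_add, Real.exp_le_exp]
    apply le_of_eq
    field_simp
    ring
  have h2 : μ.real {ω | ∑ i, z i ω ^ 2 ≤ M - M / 4} ≤ Real.exp (-(M / (256 * B))) := by
    refine (measure_le_le_exp_mul_mgf _ (by rw [neg_nonpos]; positivity) i2).trans
      ((mul_le_mul_of_nonneg_left m2 (Real.exp_pos _).le).trans ?_)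
    rw [← Real.exp_add, Real.exp_le_exp]
    apply le_of_eq
    field_simp
    ring
  calc μ.real {ω | M / 4 ≤ |∑ i, z i ω ^ 2 - M|}
      ≤ μ.real ({ω | M + M / 4 ≤ ∑ i, z i ω ^ 2} ∪ {ω | ∑ i, z i ω ^ 2 ≤ M - M / 4}) := by
        refine measureReal_mono fun ω hω => ?_
        rcases le_abs.mp (show M / 4 ≤ |∑ i, z i ω ^ 2 - M| from hω) with h | h
        · left; show M + M / 4 ≤ _; linarith
        · right; show _ ≤ M - M / 4; linarith
    _ ≤ _ := (measureReal_union_le _ _).trans (by linarith)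

/-! ### Maurey sparsification and transfer to all vectors -/

/-- The signed coordinate vectors of `ℝ^p`. -/
def signedUnit {p : ℕ} (k : Fin p × Bool) : Fin p → ℝ :=
  Pi.single k.1 (if k.2 then 1 else -1)

/-- Maurey's empirical method, in derandomized form: for a symmetric bilinear form `B` and a convex
combination `x` of the vectors `e i`, some sum of `n` of the `e i` has small quadratic form. -/
lemma exists_sum_bilin_le {V ι : Type*} [AddCommGroup V] [Module ℝ V] [Fintype ι]
    (B : V →ₗ[ℝ] V →ₗ[ℝ] ℝ) (hB : ∀ a b, B a b = B b a) (e : ι → V) {w : ι → ℝ}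
    (hw0 : ∀ i, 0 ≤ w i) (hw1 : ∑ i, w i = 1) {x : V} (hx : x = ∑ i, w i • e i) (n : ℕ) (a : V) :
    ∃ J : Fin n → ι, B (a + ∑ k, e (J k)) (a + ∑ k, e (J k)) ≤
      B (a + n • x) (a + n • x) + n * (∑ i, w i * B (e i) (e i) - B x x) := by
  induction n generalizing a with
  | zero => exact ⟨Fin.elim0, by simp⟩
  | succ n ih =>
    -- One summand `x` is replaced at a time. The right side is the `w`-average of the left, so some
    -- index does no worse. No positivity of `B` is needed.
    obtain ⟨i, hi⟩ : ∃ i, B (a + n • x + e i) (a + n • x + e i) ≤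
        B (a + n • x + x) (a + n • x + x) + (∑ i, w i * B (e i) (e i) - B x x) := by
      by_contra! hcon
      set b := a + n • x
      have h1 : ∑ i, w i * B (b + e i) (b + e i)
          = B (b + x) (b + x) + (∑ i, w i * B (e i) (e i) - B x x) := by
        have h2 : ∀ i, w i * B (b + e i) (b + e i)
            = w i * B b b + 2 * (w i * B b (e i)) + w i * B (e i) (e i) := fun i => by
          simp only [map_add, LinearMap.add_apply, hB (e i) b]; ring
        have h3 : B b x = ∑ i, w i * B b (e i) := by
          rw [hx, map_sum]
          simp
        simp only [h2, Finset.sum_add_distrib]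
        rw [← Finset.sum_mul, hw1, ← Finset.mul_sum, ← h3]
        simp only [map_add, LinearMap.add_apply, hB x b]
        ring
      obtain ⟨i₀, hi₀⟩ : ∃ i, 0 < w i := by
        by_contra! hneg
        linarith [Finset.sum_nonpos fun i (_ : i ∈ Finset.univ) => hneg i]
      have h4 : ∑ i, w i * (B (b + x) (b + x) + (∑ i, w i * B (e i) (e i) - B x x))
          < ∑ i, w i * B (b + e i) (b + e i) :=
        Finset.sum_lt_sum (fun i _ => mul_le_mul_of_nonneg_left (hcon i).le (hw0 i))
          ⟨i₀, Finset.mem_univ _, mul_lt_mul_of_pos_left (hcon i₀) hi₀⟩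
      rw [← Finset.sum_mul, hw1, one_mul, h1] at h4
      exact lt_irrefl _ h4
    obtain ⟨J, hJ⟩ := ih (a + e i)
    refine ⟨Fin.cons i J, ?_⟩
    rw [Fin.sum_univ_succ]
    simp only [Fin.cons_zero, Fin.cons_succ]
    rw [← add_assoc]
    refine hJ.trans ?_
    rw [add_right_comm a (e i) (n • x), succ_nsmul, ← add_assoc]
    push_cast
    linarith

lemma quadForm_eq_toBilin' {p : ℕ} (M : Matrix (Fin p) (Fin p) ℝ) (v : EuclideanSpace ℝ (Fin p)) :
    quadForm M v = Matrix.toBilin' M v v := by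
  rw [Matrix.toBilin'_apply]
  rfl

lemma quadForm_smul {p : ℕ} (M : Matrix (Fin p) (Fin p) ℝ) (c : ℝ)
    (v : EuclideanSpace ℝ (Fin p)) : quadForm M (c • v) = c ^ 2 * quadForm M v := by
  simp only [quadForm, Finset.mul_sum, PiLp.smul_apply, smul_eq_mul]
  exact Finset.sum_congr rfl fun i _ => Finset.sum_congr rfl fun j _ => by ring

/-- Sums of `m` signed coordinate vectors. -/
def signedSum {p m : ℕ} (J : Fin m → Fin p × Bool) : EuclideanSpace ℝ (Fin p) :=
  WithLp.toLp 2 (∑ k, signedUnit (J k))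

/-- The weights are nonnegative with total `‖x‖₁`, so a vector of unit ℓ₁ norm becomes a convex
combination of signed coordinate vectors. -/
lemma sum_posPart_negPart_smul_signedUnit {p : ℕ} (x : Fin p → ℝ) :
    x = ∑ k : Fin p × Bool, (if k.2 then (x k.1)⁺ else (x k.1)⁻) • signedUnit k := by
  ext i
  rw [Fintype.sum_prod_type]
  simp only [Fintype.sum_bool, signedUnit, if_true, Bool.false_eq_true, if_false,
    Finset.sum_apply, Pi.add_apply, Pi.smul_apply, smul_eq_mul, Pi.single_apply]
  simp [Finset.sum_add_distrib, ← sub_eq_add_neg, posPart_sub_negPart]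

lemma sum_posPart_negPart {p : ℕ} (x : Fin p → ℝ) :
    ∑ k : Fin p × Bool, (if k.2 then (x k.1)⁺ else (x k.1)⁻) = ∑ i, |x i| := by
  rw [Fintype.sum_prod_type]
  simp [posPart_add_negPart]

lemma l1norm_pos {p : ℕ} {v : EuclideanSpace ℝ (Fin p)} (hv : v ≠ 0) : 0 < l1norm v := by
  refine lt_of_le_of_ne (Finset.sum_nonneg fun i _ => abs_nonneg _) fun h => hv ?_
  ext i
  exact abs_eq_zero.mp
    ((Finset.sum_eq_zero_iff_of_nonneg fun i _ => abs_nonneg _).mp h.symm i (Finset.mem_univ i))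

lemma quadForm_toLp_signedUnit {p : ℕ} (M : Matrix (Fin p) (Fin p) ℝ) (k : Fin p × Bool) :
    quadForm M (WithLp.toLp 2 (signedUnit k)) = M k.1 k.1 := by
  rcases k with ⟨j, b⟩
  cases b <;> simp [quadForm, signedUnit, Pi.single_apply]

lemma quadForm_sub_smul {p : ℕ} (M N : Matrix (Fin p) (Fin p) ℝ) (c : ℝ)
    (v : EuclideanSpace ℝ (Fin p)) :
    quadForm (M - c • N) v = quadForm M v - c * quadForm N v := by
  simp only [quadForm_eq_toBilin', map_sub, map_smul, LinearMap.sub_apply, LinearMap.smul_apply,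
    smul_eq_mul]

/-- If two quadratic forms are close on sums of `m` signed coordinate vectors, then the first one
satisfies a restricted eigenvalue bound relative to the second one. -/
lemma quadForm_lower_bound_of_signedSum {p m : ℕ} (hm : 2 ≤ m) {G S : Matrix (Fin p) (Fin p) ℝ}
    (hG : G.IsSymm) (hS : S.IsSymm) {L : ℝ} (hL : ∀ j, S j j ≤ L)
    (h : ∀ J : Fin m → Fin p × Bool,
      |quadForm G (signedSum J) - quadForm S (signedSum J)| ≤ quadForm S (signedSum J) / 4)
    (v : EuclideanSpace ℝ (Fin p)) :
    3 / 4 * quadForm S v - L / (2 * (m - 1)) * l1norm v ^ 2 ≤ quadForm G v := by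
  have hm1 : (0 : ℝ) < m - 1 := by
    have : (2 : ℝ) ≤ m := by exact_mod_cast hm
    linarith
  have hm0 : (0 : ℝ) < m := by linarith
  rcases eq_or_ne v 0 with rfl | hv
  · simp [quadForm, l1norm]
  have hN := l1norm_pos hv
  set N := l1norm v with hNdef
  set D := G - (3 / 4 : ℝ) • S with hD
  have hDs : D.IsSymm := hG.sub (hS.smul _)
  set x : EuclideanSpace ℝ (Fin p) := N⁻¹ • v with hx
  set w : Fin p × Bool → ℝ := fun k => if k.2 then (x k.1)⁺ else (x k.1)⁻ with hw
  have hw0 : ∀ k, 0 ≤ w k := fun k => by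
    simp only [hw]; split_ifs
    · exact posPart_nonneg _
    · exact negPart_nonneg _
  have hw1 : ∑ k, w k = 1 := by
    rw [hw, sum_posPart_negPart x]
    simp only [hx, PiLp.smul_apply, smul_eq_mul, abs_mul, abs_inv, abs_of_pos hN]
    rw [← Finset.mul_sum]
    exact inv_mul_cancel₀ hN.ne'
  have hBsymm : ∀ a b, Matrix.toBilin' D a b = Matrix.toBilin' D b a := fun a b => by
    rw [Matrix.toBilin'_apply, Matrix.toBilin'_apply, Finset.sum_comm]
    exact Finset.sum_congr rfl fun i _ => Finset.sum_congr rfl fun j _ => by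
      rw [hDs.apply i j]; ring
  obtain ⟨J, hJ⟩ := exists_sum_bilin_le (Matrix.toBilin' D) hBsymm signedUnit hw0 hw1
    (sum_posPart_negPart_smul_signedUnit x) m 0
  have hJ1 : Matrix.toBilin' D (0 + ∑ k, signedUnit (J k)) (0 + ∑ k, signedUnit (J k))
      = quadForm D (signedSum J) := by
    rw [zero_add, quadForm_eq_toBilin']; rfl
  have hJ2 : Matrix.toBilin' D (0 + m • (x : Fin p → ℝ)) (0 + m • (x : Fin p → ℝ))
      = m ^ 2 * quadForm D x := by
    rw [zero_add, quadForm_eq_toBilin', map_nsmul, map_nsmul, LinearMap.smul_apply]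
    simp only [nsmul_eq_mul]
    ring
  -- The constant choice of indices yields `m` times a signed coordinate vector. The upper half of
  -- `h` then gives `D ≤ (5/4 - 3/4) S` there.
  have hdiag : ∀ k, Matrix.toBilin' D (signedUnit k) (signedUnit k) ≤ L / 2 := fun k => by
    have h1 := (abs_le.mp (h fun _ => k)).2
    have h2 : (signedSum fun _ : Fin m => k) = (m : ℝ) • WithLp.toLp 2 (signedUnit k) := by
      simp only [signedSum, Finset.sum_const, Finset.card_univ, Fintype.card_fin]
      rw [← WithLp.toLp_smul, Nat.cast_smul_eq_nsmul]
    rw [h2, quadForm_smul, quadForm_smul] at h1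
    have h3 : (m : ℝ) ^ 2 * (quadForm D (WithLp.toLp 2 (signedUnit k)))
        ≤ m ^ 2 * (quadForm S (WithLp.toLp 2 (signedUnit k)) / 2) := by
      rw [hD, quadForm_sub_smul]; linarith
    have h4 := le_of_mul_le_mul_left h3 (by positivity)
    rw [quadForm_toLp_signedUnit S] at h4
    rw [quadForm_eq_toBilin'] at h4
    exact h4.trans (by linarith [hL k.1])
  have hpos : 0 ≤ quadForm D (signedSum J) := by
    rw [hD, quadForm_sub_smul]
    linarith [(abs_le.mp (h J)).1]
  have havg : ∑ k, w k * Matrix.toBilin' D (signedUnit k) (signedUnit k) ≤ L / 2 := by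
    calc _ ≤ ∑ k, w k * (L / 2) :=
          Finset.sum_le_sum fun k _ => mul_le_mul_of_nonneg_left (hdiag k) (hw0 k)
      _ = L / 2 := by rw [← Finset.sum_mul, hw1, one_mul]
  rw [hJ1, hJ2, ← quadForm_eq_toBilin'] at hJ
  -- The term `-B x x` from Maurey's bound turns `m²` into `m(m - 1)`.
  have h5 : 0 ≤ m * ((m - 1) * quadForm D x + L / 2) := by nlinarith
  have h6 := nonneg_of_mul_nonneg_right h5 hm0
  have h7 : quadForm D v = N ^ 2 * quadForm D x := by
    rw [← quadForm_smul, hx, smul_smul, mul_inv_cancel₀ hN.ne', one_smul]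
  have h8 : -(L / (2 * (m - 1))) ≤ quadForm D x := by
    rw [neg_le_iff_add_nonneg, ← div_div]
    have : quadForm D x + L / 2 / (m - 1) = ((m - 1) * quadForm D x + L / 2) / (m - 1) := by
      field_simp
    rw [this]
    positivity
  have h9 : quadForm G v = quadForm D v + 3 / 4 * quadForm S v := by
    rw [hD, quadForm_sub_smul]; ring
  rw [h9, h7]
  nlinarith [mul_le_mul_of_nonneg_left h8 (sq_nonneg N)]

/-! ### Extreme eigenvalues and quadratic forms -/

lemma quadForm_eq_sum_eigenvalues {p : ℕ} {M : Matrix (Fin p) (Fin p) ℝ} (hM : M.IsHermitian)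
    (v : EuclideanSpace ℝ (Fin p)) :
    quadForm M v = ∑ k, hM.eigenvalues k * inner ℝ (hM.eigenvectorBasis k) v ^ 2 := by
  have h1 : quadForm M v = inner ℝ v (WithLp.toLp 2 (M *ᵥ v)) := by
    simp only [quadForm, PiLp.inner_apply, RCLike.inner_apply, conj_trivial, Matrix.mulVec,
      dotProduct, Finset.sum_mul]
    exact Finset.sum_congr rfl fun i _ => Finset.sum_congr rfl fun j _ => by ring
  have h2 : ∀ k, inner ℝ (hM.eigenvectorBasis k) (WithLp.toLp 2 (M *ᵥ v))
      = hM.eigenvalues k * inner ℝ (hM.eigenvectorBasis k) v := fun k => by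
    have h3 := hM.mulVec_eigenvectorBasis k
    have hs : Mᵀ = M := by simpa [Matrix.conjTranspose_eq_transpose_of_trivial] using hM.eq
    calc inner ℝ (hM.eigenvectorBasis k) (WithLp.toLp 2 (M *ᵥ v))
        = (M *ᵥ v) ⬝ᵥ hM.eigenvectorBasis k := by
          simp [PiLp.inner_apply, dotProduct]
      _ = (M *ᵥ hM.eigenvectorBasis k) ⬝ᵥ v := by
          rw [dotProduct_comm, Matrix.dotProduct_mulVec, ← Matrix.mulVec_transpose, hs]
      _ = hM.eigenvalues k * inner ℝ (hM.eigenvectorBasis k) v := by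
          rw [h3, smul_dotProduct, dotProduct_comm]
          simp [PiLp.inner_apply, dotProduct]
  rw [h1, ← hM.eigenvectorBasis.sum_inner_mul_inner]
  exact Finset.sum_congr rfl fun k _ => by rw [h2, real_inner_comm]; ring

lemma lambdaMin_mul_le_quadForm {p : ℕ} {M : Matrix (Fin p) (Fin p) ℝ} (hM : M.IsHermitian)
    (v : EuclideanSpace ℝ (Fin p)) : lambdaMin M * ‖v‖ ^ 2 ≤ quadForm M v := by
  rw [quadForm_eq_sum_eigenvalues hM, ← hM.eigenvectorBasis.sum_sq_norm_inner_right v,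
    Finset.mul_sum]
  simp only [Real.norm_eq_abs, sq_abs]
  exact Finset.sum_le_sum fun k _ => mul_le_mul_of_nonneg_right
    (csInf_le (Matrix.finite_real_spectrum (A := M)).bddBelow (hM.eigenvalues_mem_spectrum_real k))
    (sq_nonneg _)

lemma quadForm_le_lambdaMax_mul {p : ℕ} {M : Matrix (Fin p) (Fin p) ℝ} (hM : M.IsHermitian)
    (v : EuclideanSpace ℝ (Fin p)) : quadForm M v ≤ lambdaMax M * ‖v‖ ^ 2 := by
  rw [quadForm_eq_sum_eigenvalues hM, ← hM.eigenvectorBasis.sum_sq_norm_inner_right v,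
    Finset.mul_sum]
  simp only [Real.norm_eq_abs, sq_abs]
  exact Finset.sum_le_sum fun k _ => mul_le_mul_of_nonneg_right
    (le_csSup (Matrix.finite_real_spectrum (A := M)).bddAbove (hM.eigenvalues_mem_spectrum_real k))
    (sq_nonneg _)

lemma lambdaMin_nonneg {p : ℕ} {M : Matrix (Fin p) (Fin p) ℝ} (hM : M.IsHermitian)
    (h : ∀ v, 0 ≤ quadForm M v) : 0 ≤ lambdaMin M := by
  refine Real.sInf_nonneg fun r hr => ?_
  rw [hM.spectrum_real_eq_range_eigenvalues] at hr
  obtain ⟨k, rfl⟩ := hr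
  have := h (hM.eigenvectorBasis k)
  rw [quadForm_eq_sum_eigenvalues hM] at this
  simpa [hM.eigenvectorBasis.inner_eq_ite] using this

/-! ### One-dimensional projections of the process -/

section Projections

variable {Ω : Type*} [MeasurableSpace Ω] {μ : Measure Ω} {p q : ℕ}
  {X : ℕ → Ω → EuclideanSpace ℝ (Fin p)} {Y : ℕ → Ω → EuclideanSpace ℝ (Fin q)}
  {Z : ℕ → Ω → EuclideanSpace ℝ (Fin p) × EuclideanSpace ℝ (Fin q)}

lemma isGaussianProcess_inner (hZ : ∀ t ω, Z t ω = (X t ω, Y t ω)) (hgauss : IsGaussianProcess Z μ)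
    (u : EuclideanSpace ℝ (Fin p)) : IsGaussianProcess (fun t ω => inner ℝ u (X t ω)) μ := by
  have := hgauss.comp_left fun _ => (innerSL ℝ u).comp
    (ContinuousLinearMap.fst ℝ (EuclideanSpace ℝ (Fin p)) (EuclideanSpace ℝ (Fin q)))
  simpa [hZ] using this

lemma integral_inner_eq_zero (hZ : ∀ t ω, Z t ω = (X t ω, Y t ω)) (hgauss : IsGaussianProcess Z μ)
    (hcent : ∀ t, ∫ ω, X t ω ∂μ = 0) (u : EuclideanSpace ℝ (Fin p)) (t : ℕ) :
    ∫ ω, inner ℝ u (X t ω) ∂μ = 0 := by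
  have h1 := (hgauss.hasGaussianLaw_eval t).map_fun
    (ContinuousLinearMap.fst ℝ (EuclideanSpace ℝ (Fin p)) (EuclideanSpace ℝ (Fin q)))
  simp only [hZ, ContinuousLinearMap.coe_fst'] at h1
  rw [integral_inner h1.integrable, hcent, inner_zero_right]

lemma integral_inner_sq_eq (hZ : ∀ t ω, Z t ω = (X t ω, Y t ω)) (hstat : IsStrictlyStationary μ Z)
    (u : EuclideanSpace ℝ (Fin p)) (t : ℕ) :
    ∫ ω, inner ℝ u (X t ω) ^ 2 ∂μ = ∫ ω, inner ℝ u (X 0 ω) ^ 2 ∂μ := by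
  have hg : Measurable fun f : Fin (0 + 1) → EuclideanSpace ℝ (Fin p) × EuclideanSpace ℝ (Fin q) =>
      (inner ℝ u (f 0).1 : ℝ) ^ 2 := by fun_prop
  have := ((hstat 0 t 0).comp hg).integral_eq
  simpa [Function.comp_def, hZ] using this.symm

lemma integral_inner_sq_eq_quadForm (hZ : ∀ t ω, Z t ω = (X t ω, Y t ω))
    (hgauss : IsGaussianProcess Z μ) (u : EuclideanSpace ℝ (Fin p)) :
    ∫ ω, inner ℝ u (X 0 ω) ^ 2 ∂μ = quadForm (covMatrix μ X) u := by
  have hL2 : ∀ i, MemLp (fun ω => X 0 ω i) 2 μ := fun i => by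
    have := ((isGaussianProcess_inner hZ hgauss
      (EuclideanSpace.single i 1)).hasGaussianLaw_eval 0).memLp_two
    simpa [EuclideanSpace.inner_single_left] using this
  have hint : ∀ i j, Integrable (fun ω => X 0 ω i * X 0 ω j) μ := fun i j =>
    (hL2 i).integrable_mul (hL2 j)
  have e : ∀ ω, (inner ℝ u (X 0 ω) : ℝ) ^ 2 = ∑ i, ∑ j, u i * u j * (X 0 ω i * X 0 ω j) :=
    fun ω => by
      simp only [PiLp.inner_apply, RCLike.inner_apply, conj_trivial]
      rw [sq, Finset.sum_mul_sum]
      exact Finset.sum_congr rfl fun i _ => Finset.sum_congr rfl fun j _ => by ring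
  simp only [e]
  rw [integral_finsetSum _ fun i _ => integrable_finsetSum _ fun j _ => (hint i j).const_mul _]
  refine Finset.sum_congr rfl fun i _ => ?_
  rw [integral_finsetSum _ fun j _ => (hint i j).const_mul _]
  refine Finset.sum_congr rfl fun j _ => ?_
  rw [integral_const_mul]
  simp only [covMatrix, Matrix.of_apply]
  ring

lemma quadForm_sampleCov {Ω : Type*} {p : ℕ} (X : ℕ → Ω → EuclideanSpace ℝ (Fin p)) (T : ℕ)
    (ω : Ω) (u : EuclideanSpace ℝ (Fin p)) :
    quadForm (sampleCov X T ω) u = (T : ℝ)⁻¹ * ∑ t : Fin T, (inner ℝ u (X t ω) : ℝ) ^ 2 := by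
  have e : ∀ t : Fin T, (inner ℝ u (X t ω) : ℝ) ^ 2
      = ∑ i, ∑ j, u i * u j * (X t ω i * X t ω j) := fun t => by
    simp only [PiLp.inner_apply, RCLike.inner_apply, conj_trivial]
    rw [sq, Finset.sum_mul_sum]
    exact Finset.sum_congr rfl fun i _ => Finset.sum_congr rfl fun j _ => by ring
  simp only [e]
  rw [Finset.sum_comm, Finset.mul_sum]
  refine Finset.sum_congr rfl fun i _ => ?_
  rw [Finset.sum_comm, Finset.mul_sum]
  refine Finset.sum_congr rfl fun j _ => ?_
  rw [← Finset.mul_sum]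
  simp only [sampleCov, designMatrix, Matrix.smul_apply, Matrix.mul_apply, Matrix.transpose_apply,
    Matrix.of_apply, smul_eq_mul]
  ring

lemma sampleCov_isSymm {Ω : Type*} {p : ℕ} (X : ℕ → Ω → EuclideanSpace ℝ (Fin p)) (T : ℕ)
    (ω : Ω) : (sampleCov X T ω).IsSymm := by
  rw [Matrix.IsSymm, sampleCov, Matrix.transpose_smul, Matrix.transpose_mul,
    Matrix.transpose_transpose]

lemma covMatrix_isSymm (μ : Measure Ω) (X : ℕ → Ω → EuclideanSpace ℝ (Fin p)) :
    (covMatrix μ X).IsSymm :=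
  Matrix.IsSymm.ext fun i j => by simp [covMatrix, mul_comm]

/-- The two projections are measurable for the past up to `s` and the future from `s + l`, so the
Gaussian pair bound applies with the variance common to both times. -/
lemma abs_integral_inner_mul_inner_le [IsProbabilityMeasure μ] (hZ : ∀ t ω, Z t ω = (X t ω, Y t ω))
    (hmeas : ∀ t, Measurable (Z t)) (hstat : IsStrictlyStationary μ Z)
    (hcent : ∀ t, ∫ ω, X t ω ∂μ = 0) (hgauss : IsGaussianProcess Z μ)
    {u : EuclideanSpace ℝ (Fin p)} (hu : 0 < quadForm (covMatrix μ X) u) (s l : ℕ) :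
    |∫ ω, inner ℝ u (X s ω) * inner ℝ u (X (s + l) ω) ∂μ|
      ≤ 4 * Real.exp 1 * alphaCoef μ Z l * quadForm (covMatrix μ X) u := by
  have hcomp : ∀ t, (fun ω => (inner ℝ u (X t ω) : ℝ))
      = (fun z : EuclideanSpace ℝ (Fin p) × EuclideanSpace ℝ (Fin q) => (inner ℝ u z.1 : ℝ))
        ∘ Z t := fun t => by ext ω; simp [hZ]
  have hg : Measurable fun z : EuclideanSpace ℝ (Fin p) × EuclideanSpace ℝ (Fin q) =>
      (inner ℝ u z.1 : ℝ) := by fun_prop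
  have hpast : pastSigma Z s ≤ (inferInstance : MeasurableSpace Ω) :=
    iSup_le fun t => (hmeas t).comap_le
  have hfut : futureSigma Z (s + l) ≤ (inferInstance : MeasurableSpace Ω) :=
    iSup_le fun t => (hmeas t).comap_le
  have hU : Measurable[pastSigma Z s] fun ω => (inner ℝ u (X s ω) : ℝ) := by
    rw [hcomp]
    exact hg.comp (Measurable.of_comap_le
      (le_iSup (fun t : {t : ℕ // t ≤ s} => MeasurableSpace.comap (Z t) inferInstance) ⟨s, le_rfl⟩))
  have hV : Measurable[futureSigma Z (s + l)] fun ω => (inner ℝ u (X (s + l) ω) : ℝ) := by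
    rw [hcomp]
    exact hg.comp (Measurable.of_comap_le
      (le_iSup (fun t : {t : ℕ // s + l ≤ t} => MeasurableSpace.comap (Z t) inferInstance)
        ⟨s + l, le_rfl⟩))
  have hvar : ∀ t, ∫ ω, inner ℝ u (X t ω) ^ 2 ∂μ = quadForm (covMatrix μ X) u := fun t => by
    rw [integral_inner_sq_eq hZ hstat, integral_inner_sq_eq_quadForm hZ hgauss]
  refine (abs_integral_mul_le_alphaDep hpast hfut hU hV
    (isGaussianProcess_inner hZ hgauss u).hasGaussianLaw_prodMk
    (integral_inner_eq_zero hZ hgauss hcent u s) (integral_inner_eq_zero hZ hgauss hcent u _)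
    hu (hvar s) (hvar _)).trans ?_
  gcongr
  exact alphaDep_le_alphaCoef μ Z s l

/-- At lag zero the two projections coincide and have correlation one, so the pair bound itself
forces `4e α(0) ≥ 1`. This keeps `S_α(T)` away from zero. -/
lemma one_le_alphaSum [IsProbabilityMeasure μ] (hZ : ∀ t ω, Z t ω = (X t ω, Y t ω))
    (hmeas : ∀ t, Measurable (Z t)) (hstat : IsStrictlyStationary μ Z)
    (hcent : ∀ t, ∫ ω, X t ω ∂μ = 0) (hgauss : IsGaussianProcess Z μ)
    {u : EuclideanSpace ℝ (Fin p)} (hu : 0 < quadForm (covMatrix μ X) u) (T : ℕ) :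
    1 ≤ 4 * Real.exp 1 * alphaSum μ Z T := by
  have h := abs_integral_inner_mul_inner_le hZ hmeas hstat hcent hgauss hu 0 0
  simp only [add_zero, ← sq] at h
  rw [integral_inner_sq_eq_quadForm hZ hgauss, abs_of_pos hu] at h
  have h1 : 1 ≤ 4 * Real.exp 1 * alphaCoef μ Z 0 := by
    by_contra! hlt
    nlinarith
  refine h1.trans ?_
  gcongr
  exact Finset.single_le_sum (f := fun l => alphaCoef μ Z l)
    (fun l _ => alphaCoef_nonneg μ Z l) (Finset.mem_range.mpr (Nat.succ_pos T))

end Projections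

/-! ### Concentration of the sample covariance, in one direction and uniformly -/

/-- Each lag is attained at most once on either side of `t`; this turns a row of covariances into
twice a sum over lags. -/
lemma sum_two_sided_le {T : ℕ} (t : Fin T) {f : ℕ → ℝ} (hf : ∀ l, 0 ≤ f l) {g : Fin T → ℝ}
    (h1 : ∀ s : Fin T, ∀ l : ℕ, (s : ℕ) + l = t → g s ≤ f l)
    (h2 : ∀ s : Fin T, ∀ l : ℕ, (t : ℕ) + l = s → g s ≤ f l) :
    ∑ s, g s ≤ 2 * ∑ l ∈ Finset.range (T + 1), f l := by
  have hcard : ∀ (P : Fin T → Prop) [DecidablePred P], (∀ a b, P a → P b → a = b) →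
      ∀ c : ℝ, 0 ≤ c → ∑ s, (if P s then c else 0) ≤ c := fun P _ hP c hc => by
    rw [← Finset.sum_filter, Finset.sum_const, nsmul_eq_mul]
    have : (Finset.univ.filter P).card ≤ 1 := Finset.card_le_one.mpr fun a ha b hb =>
      hP a b (Finset.mem_filter.mp ha).2 (Finset.mem_filter.mp hb).2
    have : ((Finset.univ.filter P).card : ℝ) ≤ 1 := by exact_mod_cast this
    nlinarith
  have hg : ∀ s, g s ≤ ∑ l ∈ Finset.range (T + 1),
      ((if (s : ℕ) + l = t then f l else 0) + if (t : ℕ) + l = s then f l else 0) := fun s => by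
    have hn : ∀ l ∈ Finset.range (T + 1),
        0 ≤ (if (s : ℕ) + l = t then f l else 0) + if (t : ℕ) + l = s then f l else 0 :=
      fun l _ => by have := hf l; split_ifs <;> positivity
    have := t.2
    have := s.2
    rcases le_total (s : ℕ) t with h | h
    · obtain ⟨l, hl⟩ := Nat.exists_eq_add_of_le h
      refine le_trans ?_ (Finset.single_le_sum hn (Finset.mem_range.mpr (by omega : l < T + 1)))
      rw [if_pos hl.symm]
      have h3 := h1 s l hl.symm
      have := hf l
      split_ifs <;> linarith
    · obtain ⟨l, hl⟩ := Nat.exists_eq_add_of_le h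
      refine le_trans ?_ (Finset.single_le_sum hn (Finset.mem_range.mpr (by omega : l < T + 1)))
      rw [if_pos hl.symm]
      have h3 := h2 s l hl.symm
      have := hf l
      split_ifs <;> linarith
  refine (Finset.sum_le_sum fun s _ => hg s).trans ?_
  rw [Finset.sum_comm, Finset.mul_sum]
  refine Finset.sum_le_sum fun l _ => ?_
  rw [Finset.sum_add_distrib, two_mul]
  exact add_le_add (hcard _ (fun a b ha hb => Fin.ext (by omega)) _ (hf l))
    (hcard _ (fun a b ha hb => Fin.ext (by omega)) _ (hf l))

section Projections

variable {Ω : Type*} [MeasurableSpace Ω] {μ : Measure Ω} {p q : ℕ}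
  {X : ℕ → Ω → EuclideanSpace ℝ (Fin p)} {Y : ℕ → Ω → EuclideanSpace ℝ (Fin q)}
  {Z : ℕ → Ω → EuclideanSpace ℝ (Fin p) × EuclideanSpace ℝ (Fin q)}

/-- Relative concentration of the sample second moment in a fixed direction. -/
lemma measureReal_quadForm_deviation_le [IsProbabilityMeasure μ]
    (hZ : ∀ t ω, Z t ω = (X t ω, Y t ω))
    (hmeas : ∀ t, Measurable (Z t)) (hstat : IsStrictlyStationary μ Z)
    (hcent : ∀ t, ∫ ω, X t ω ∂μ = 0) (hgauss : IsGaussianProcess Z μ) {T : ℕ} (hT : 0 < T)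
    {u : EuclideanSpace ℝ (Fin p)} (hu : 0 < quadForm (covMatrix μ X) u) :
    μ.real {ω | quadForm (covMatrix μ X) u / 4 <
        |quadForm (sampleCov X T ω) u - quadForm (covMatrix μ X) u|}
      ≤ 2 * Real.exp (-(T / (2048 * Real.exp 1 * alphaSum μ Z T))) := by
  set v := quadForm (covMatrix μ X) u with hv
  set S := alphaSum μ Z T with hS
  have hS1 : 1 ≤ 4 * Real.exp 1 * S := one_le_alphaSum hZ hmeas hstat hcent hgauss hu T
  have he := Real.exp_pos 1
  have hS0 : 0 < S := by
    by_contra! h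
    nlinarith
  have hT0 : (0 : ℝ) < T := by exact_mod_cast hT
  have hproc := isGaussianProcess_inner hZ hgauss u
  have hG : HasGaussianLaw (fun ω (t : Fin T) => (inner ℝ u (X t ω) : ℝ)) μ := by
    let L : ((Finset.range T) → ℝ) →L[ℝ] (Fin T → ℝ) := ContinuousLinearMap.pi fun t : Fin T =>
      ContinuousLinearMap.proj ⟨(t : ℕ), Finset.mem_range.mpr t.2⟩
    exact (hproc.hasGaussianLaw (Finset.range T)).map_fun L
  have hXm : ∀ t, Measurable (X t) := fun t => by
    have : X t = fun ω => (Z t ω).1 := by ext1 ω; simp [hZ]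
    rw [this]
    exact (hmeas t).fst
  have hrow : ∀ t : Fin T, ∑ s : Fin T, |∫ ω, inner ℝ u (X t ω) * inner ℝ u (X s ω) ∂μ|
      ≤ 8 * Real.exp 1 * S * v := fun t => by
    refine (sum_two_sided_le t (f := fun l => 4 * Real.exp 1 * alphaCoef μ Z l * v)
      (fun l => by have := alphaCoef_nonneg μ Z l; positivity) (fun s l hl => ?_)
      fun s l hl => ?_).trans (le_of_eq ?_)
    · have := abs_integral_inner_mul_inner_le hZ hmeas hstat hcent hgauss hu s l
      rw [hl] at this
      simpa only [mul_comm] using this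
    · have := abs_integral_inner_mul_inner_le hZ hmeas hstat hcent hgauss hu t l
      rwa [hl] at this
    · rw [hS, alphaSum, ← Finset.sum_mul, ← Finset.mul_sum]
      ring
  have hvar : ∀ t, ∫ ω, inner ℝ u (X t ω) ^ 2 ∂μ = v := fun t => by
    rw [integral_inner_sq_eq hZ hstat, integral_inner_sq_eq_quadForm hZ hgauss]
  have hM : ∑ t : Fin T, ∫ ω, inner ℝ u (X t ω) ^ 2 ∂μ = T * v := by simp [hvar]
  have key := measureReal_sum_sq_deviation_le
    (z := fun (t : Fin T) ω => (inner ℝ u (X t ω) : ℝ))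
    (fun t => by have := hXm t; fun_prop) hG (fun t => integral_inner_eq_zero hZ hgauss hcent u t)
    (by positivity) hrow hM
  have e : T * v / (256 * (8 * Real.exp 1 * S * v)) = T / (2048 * Real.exp 1 * S) := by
    field_simp
    norm_num
  rw [e] at key
  refine (measureReal_mono fun ω hω => ?_).trans key
  have hω' : v / 4 < |quadForm (sampleCov X T ω) u - v| := hω
  rw [quadForm_sampleCov] at hω'
  change T * v / 4 ≤ |_ - T * v|
  have e2 : ∑ t : Fin T, (inner ℝ u (X t ω) : ℝ) ^ 2 - T * v
      = T * ((T : ℝ)⁻¹ * ∑ t : Fin T, (inner ℝ u (X t ω) : ℝ) ^ 2 - v) := by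
    field_simp
  rw [e2, abs_mul, abs_of_pos hT0, mul_div_assoc]
  exact (mul_lt_mul_of_pos_left hω' hT0).le

/-- Uniform relative concentration over sums of `m` signed coordinate vectors. -/
lemma measureReal_exists_signedSum_deviation_le [IsProbabilityMeasure μ]
    (hZ : ∀ t ω, Z t ω = (X t ω, Y t ω))
    (hmeas : ∀ t, Measurable (Z t)) (hstat : IsStrictlyStationary μ Z)
    (hcent : ∀ t, ∫ ω, X t ω ∂μ = 0) (hgauss : IsGaussianProcess Z μ) {T : ℕ} (hT : 0 < T)
    (hpos : ∀ u ≠ 0, 0 < quadForm (covMatrix μ X) u) (m : ℕ) :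
    μ.real {ω | ∃ J : Fin m → Fin p × Bool, quadForm (covMatrix μ X) (signedSum J) / 4 <
        |quadForm (sampleCov X T ω) (signedSum J) - quadForm (covMatrix μ X) (signedSum J)|}
      ≤ (2 * p) ^ m * (2 * Real.exp (-(T / (2048 * Real.exp 1 * alphaSum μ Z T)))) := by
  rw [Set.ofPred_exists]
  refine (measureReal_iUnion_fintype_le _).trans ?_
  refine (Finset.sum_le_card_nsmul _ _
    (2 * Real.exp (-(T / (2048 * Real.exp 1 * alphaSum μ Z T)))) fun J _ => ?_).trans (le_of_eq ?_)
  -- Signed vectors may cancel. For a zero sum the event is empty, because its inequality is strict.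
  · rcases eq_or_ne (signedSum J) 0 with h | h
    · rw [h]
      simp only [quadForm, PiLp.zero_apply, zero_mul, Finset.sum_const_zero, zero_div, sub_zero,
        abs_zero, lt_irrefl, Set.ofPred_false, measureReal_empty]
      positivity
    · exact measureReal_quadForm_deviation_le hZ hmeas hstat hcent hgauss hT (hpos _ h)
  · simp [mul_comm]

lemma measurableSet_exists_signedSum (hmeas : ∀ t, Measurable (X t)) (T m : ℕ)
    (S : Matrix (Fin p) (Fin p) ℝ) :
    MeasurableSet {ω | ∃ J : Fin m → Fin p × Bool, quadForm S (signedSum J) / 4 <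
        |quadForm (sampleCov X T ω) (signedSum J) - quadForm S (signedSum J)|} := by
  rw [Set.ofPred_exists]
  refine MeasurableSet.iUnion fun J => ?_
  simp only [quadForm_sampleCov]
  refine measurableSet_lt measurable_const ?_
  fun_prop

end Projections

/-! ### Choice of constants and conclusion -/

/-- Numerical comparison of the entropy of the sparse class with the concentration exponent. -/
lemma entropy_le {p m T s : ℕ} (hp : 2 ≤ p) {S κ η ε : ℝ} (hS : 1 ≤ 4 * Real.exp 1 * S)
    (hκ : 1 ≤ κ) (hη : η = 1 / (108 * Real.pi * S * κ)) (hε0 : 0 ≤ ε) (hε : ε ≤ η ^ 2)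
    (hs : 1 ≤ s) (hs2 : (s : ℝ) ≤ 2 * (1 / 10 * (T / (4 * Real.log p)) * ε))
    (hm : (m : ℝ) ≤ 2 + s * κ) :
    (2 * p) ^ m * (2 * Real.exp (-(T / (2048 * Real.exp 1 * S))))
      ≤ 2 * Real.exp (-(1 / 10 / 2) * T * ε) := by
  have hp2 : (2 : ℝ) ≤ p := by exact_mod_cast hp
  have hs1 : (1 : ℝ) ≤ s := by exact_mod_cast hs
  have hlog : 0 < Real.log p := Real.log_pos (by linarith)
  have he := Real.exp_pos 1
  have hS0 : 0 < S := by
    by_contra! h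
    nlinarith
  have hT0 : (0 : ℝ) ≤ T := Nat.cast_nonneg T
  have hlog2 : Real.log (2 * p) ≤ 2 * Real.log p := by
    rw [Real.log_mul two_ne_zero (by linarith), two_mul]
    exact add_le_add_left (Real.log_le_log two_pos hp2) _
  have hsκ : 1 ≤ s * κ := by nlinarith
  have hm3 : (m : ℝ) ≤ 3 * (s * κ) := by linarith
  have hpow : (2 * (p : ℝ)) ^ m ≤ Real.exp (6 * (s * κ) * Real.log p) := by
    rw [← Real.exp_log (by positivity : 0 < (2 * (p : ℝ)) ^ m), Real.log_pow, Real.exp_le_exp]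
    calc (m : ℝ) * Real.log (2 * p) ≤ 3 * (s * κ) * (2 * Real.log p) :=
          mul_le_mul hm3 hlog2 (Real.log_nonneg (by linarith)) (by positivity)
      _ = _ := by ring
  have hslog : s * Real.log p ≤ T * ε / 20 := by
    calc s * Real.log p ≤ 2 * (1 / 10 * (T / (4 * Real.log p)) * ε) * Real.log p :=
          mul_le_mul_of_nonneg_right hs2 hlog.le
      _ = T * ε / 20 := by field_simp; ring
  -- The entropy costs `(3/10) κεT` and the target probability `(1/20) εT`; as `κ ≥ 1`, together at
  -- most `(7/20) κεT`.
  have hexp : 6 * (s * κ) * Real.log p ≤ 3 / 10 * (κ * ε) * T := by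
    nlinarith [mul_le_mul_of_nonneg_right hslog (by linarith : 0 ≤ κ)]
  -- The factor `κ` from the size of `m` is absorbed by the `κ²` in the denominator of `η²`, and
  -- `4eS ≥ 1` trades `S²` for `S`.
  have hκε : κ * ε ≤ 1 / (1500 * S * (2 * Real.exp 1)) := by
    have h1 : κ * ε ≤ κ * η ^ 2 := mul_le_mul_of_nonneg_left hε (by linarith)
    have h2 : κ * η ^ 2 = 1 / ((108 * Real.pi) ^ 2 * S ^ 2 * κ) := by
      rw [hη]; field_simp
    rw [h2] at h1
    refine h1.trans (one_div_le_one_div_of_le (by positivity) ?_)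
    have h3 : (4 * 1500 * Real.exp 1 ^ 2 * 2 : ℝ) ≤ (108 * Real.pi) ^ 2 := by
      have := Real.exp_one_lt_d9
      have := Real.pi_gt_three
      nlinarith
    have h4 : 1500 * S * (2 * Real.exp 1) ≤ 4 * 1500 * Real.exp 1 ^ 2 * 2 * S ^ 2 := by
      nlinarith [mul_le_mul_of_nonneg_left hS (by positivity : 0 ≤ 3000 * S * Real.exp 1)]
    calc 1500 * S * (2 * Real.exp 1) ≤ 4 * 1500 * Real.exp 1 ^ 2 * 2 * S ^ 2 := h4
      _ ≤ (108 * Real.pi) ^ 2 * S ^ 2 := mul_le_mul_of_nonneg_right h3 (by positivity)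
      _ ≤ (108 * Real.pi) ^ 2 * S ^ 2 * κ := le_mul_of_one_le_right (by positivity) hκ
  have hεκ : ε ≤ κ * ε := le_mul_of_one_le_left hε0 hκ
  have hfin : 3 / 10 * (κ * ε) * T + 1 / 20 * T * ε ≤ T / (2048 * Real.exp 1 * S) := by
    have h5 : 7 / 20 * (κ * ε) ≤ 1 / (2048 * Real.exp 1 * S) := by
      calc 7 / 20 * (κ * ε) ≤ 7 / 20 * (1 / (1500 * S * (2 * Real.exp 1))) := by linarith
        _ = (7 / 20 * 2048 / 3000) * (1 / (2048 * Real.exp 1 * S)) := by field_simp; norm_num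
        _ ≤ 1 / (2048 * Real.exp 1 * S) :=
          mul_le_of_le_one_left (by positivity) (by norm_num)
    calc 3 / 10 * (κ * ε) * T + 1 / 20 * T * ε ≤ 7 / 20 * (κ * ε) * T := by
          nlinarith [mul_le_mul_of_nonneg_right hεκ hT0]
      _ ≤ 1 / (2048 * Real.exp 1 * S) * T := mul_le_mul_of_nonneg_right h5 hT0
      _ = _ := by ring
  calc (2 * (p : ℝ)) ^ m * (2 * Real.exp (-(T / (2048 * Real.exp 1 * S))))
      ≤ Real.exp (6 * (s * κ) * Real.log p) * (2 * Real.exp (-(T / (2048 * Real.exp 1 * S)))) :=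
        mul_le_mul_of_nonneg_right hpow (by positivity)
    _ = 2 * Real.exp (6 * (s * κ) * Real.log p + -(T / (2048 * Real.exp 1 * S))) := by
        rw [Real.exp_add]; ring
    _ ≤ _ := by
        refine mul_le_mul_of_nonneg_left (Real.exp_le_exp.mpr ?_) two_pos.le
        linarith

end GaussRE

open GaussRE

theorem mainTheorem6 :
    ∃ c : ℝ, 0 < c ∧
      ∀ (Ω : Type*) [MeasurableSpace Ω] (μ : Measure Ω) [IsProbabilityMeasure μ]
        (p q T : ℕ) (_hp : 2 ≤ p)
        (X : ℕ → Ω → EuclideanSpace ℝ (Fin p)) (Y : ℕ → Ω → EuclideanSpace ℝ (Fin q))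
        (Z : ℕ → Ω → EuclideanSpace ℝ (Fin p) × EuclideanSpace ℝ (Fin q))
        (_hZ : ∀ t ω, Z t ω = (X t ω, Y t ω))
        (_hmeas : ∀ t, Measurable (Z t))
        (_hstat : GaussRE.IsStrictlyStationary μ Z)
        (_hcentX : ∀ t, ∫ ω, X t ω ∂μ = 0) (_hcentY : ∀ t, ∫ ω, Y t ω ∂μ = 0)
        (_hgauss : IsGaussianProcess Z μ)
        (_hmix : GaussRE.IsAlphaMixing μ Z)
        (η a τ : ℝ)
        (_hη : η = GaussRE.lambdaMin (GaussRE.covMatrix μ X) /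
          (108 * Real.pi * GaussRE.alphaSum μ Z T * GaussRE.lambdaMax (GaussRE.covMatrix μ X)))
        (_ha : a = GaussRE.lambdaMin (GaussRE.covMatrix μ X) / 2)
        (_hτ : τ = a / ⌈c * (T / (4 * Real.log p)) * min 1 (η ^ 2)⌉₊)
        (_hT : 42 * Real.exp 1 * Real.log p / (c * min 1 (η ^ 2)) ≤ T),
        1 - 2 * Real.exp (-(c / 2) * T * min 1 (η ^ 2)) ≤
          μ.real {ω | GaussRE.LowerRE (GaussRE.sampleCov X T ω) a τ ∧
            ∀ v : EuclideanSpace ℝ (Fin p), v ≠ 0 →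
              a * ‖v‖ ^ 2 - τ * GaussRE.l1norm v ^ 2 <
                |GaussRE.quadForm (GaussRE.sampleCov X T ω) v|} := by
  refine ⟨1 / 10, by norm_num, ?_⟩
  intro Ω _ μ _ p q T hp X Y Z hZ hmeas hstat hcent _ hgauss _ η a τ hη ha hτ hT
  set Sg := covMatrix μ X with hSg
  set lo := lambdaMin Sg with hlo
  set hi := lambdaMax Sg with hhi
  set S := alphaSum μ Z T with hS
  set ε := min 1 (η ^ 2) with hε
  -- Here the claimed probability bound is `1 - 2 < 0`. Otherwise `η ≠ 0` forces `λ_min > 0`.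
  rcases eq_or_ne η 0 with h0 | h0
  · have : ε = 0 := by rw [hε, h0]; norm_num
    rw [this, mul_zero, Real.exp_zero]
    exact le_trans (by norm_num) measureReal_nonneg
  have hSs : Sg.IsSymm := covMatrix_isSymm μ X
  have hSH : Sg.IsHermitian := by
    rw [Matrix.IsHermitian, Matrix.conjTranspose_eq_transpose_of_trivial]; exact hSs
  have hquad0 : ∀ v, 0 ≤ quadForm Sg v := fun v => by
    rw [hSg, ← integral_inner_sq_eq_quadForm hZ hgauss]
    exact integral_nonneg fun ω => sq_nonneg _
  have hlo0 : 0 < lo := by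
    refine lt_of_le_of_ne (lambdaMin_nonneg hSH hquad0) fun h => h0 ?_
    rw [hη, ← h, zero_div]
  have hpos : ∀ u ≠ 0, 0 < quadForm Sg u := fun u hu =>
    (by have := norm_pos_iff.mpr hu; positivity : 0 < lo * ‖u‖ ^ 2).trans_le
      (lambdaMin_mul_le_quadForm hSH u)
  obtain ⟨u₀, hu₀⟩ : ∃ u : EuclideanSpace ℝ (Fin p), u ≠ 0 :=
    ⟨EuclideanSpace.single ⟨0, by omega⟩ 1, by simp⟩
  have hS1 : 1 ≤ 4 * Real.exp 1 * S :=
    one_le_alphaSum hZ hmeas hstat hcent hgauss (hpos u₀ hu₀) T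
  have hlohi : lo ≤ hi := by
    have h1 := (lambdaMin_mul_le_quadForm hSH u₀).trans (quadForm_le_lambdaMax_mul hSH u₀)
    exact le_of_mul_le_mul_right h1 (by have := norm_pos_iff.mpr hu₀; positivity)
  have hhi0 : 0 < hi := hlo0.trans_le hlohi
  have hε0 : 0 < ε := lt_min one_pos (by positivity)
  have hp2 : (2 : ℝ) ≤ p := by exact_mod_cast hp
  have hlog : 0 < Real.log p := Real.log_pos (by linarith)
  have he : 2 < Real.exp 1 := by linarith [Real.exp_one_gt_d9]
  have hTε : 42 * Real.exp 1 * Real.log p ≤ 1 / 10 * T * ε := by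
    rw [div_le_iff₀ (by positivity)] at hT
    linarith
  have hT0 : 0 < T := by
    rcases Nat.eq_zero_or_pos T with h | h
    · rw [h, Nat.cast_zero, mul_zero, zero_mul] at hTε
      have : 0 < 42 * Real.exp 1 * Real.log p := by positivity
      linarith
    · exact h
  set x : ℝ := 1 / 10 * (T / (4 * Real.log p)) * ε with hx
  -- This is where the sample size hypothesis enters: `x ≥ 1` makes the ceiling cost at most a
  -- factor `2`.
  have hx1 : 1 ≤ x := by
    have : x = 1 / 10 * T * ε / (4 * Real.log p) := by rw [hx]; ring
    rw [this, le_div_iff₀ (by positivity)]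
    nlinarith
  set s := ⌈x⌉₊ with hs
  have hs1 : 1 ≤ s := Nat.one_le_iff_ne_zero.mpr (Nat.ceil_pos.mpr (by linarith)).ne'
  have hs2 : (s : ℝ) ≤ 2 * x := by linarith [Nat.ceil_lt_add_one (by linarith : 0 ≤ x)]
  have hs0 : (1 : ℝ) ≤ s := by exact_mod_cast hs1
  have hκ : 1 ≤ hi / lo := (one_le_div hlo0).mpr hlohi
  have hsκ : 1 ≤ s * (hi / lo) := by nlinarith
  -- The extra `1` offsets the `m - 1` in Maurey's bound, so that the tolerance `hi / (2(m - 1))` is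
  -- at most `lo / (2s) = τ`.
  set m := 1 + ⌈s * (hi / lo)⌉₊ with hm
  have hm1 : s * (hi / lo) ≤ (m : ℝ) - 1 := by
    rw [hm]; push_cast; linarith [Nat.le_ceil (s * (hi / lo))]
  have hm2 : (m : ℝ) ≤ 2 + s * (hi / lo) := by
    rw [hm]; push_cast
    linarith [Nat.ceil_lt_add_one (by linarith : 0 ≤ s * (hi / lo))]
  have hm3 : 2 ≤ m := by
    have := Nat.one_le_iff_ne_zero.mpr (Nat.ceil_pos.mpr (by linarith : 0 < s * (hi / lo))).ne'
    omega
  have hτ0 : 0 < τ := by rw [hτ, ha]; positivity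
  have hdiag : ∀ j, Sg j j ≤ hi := fun j => by
    have := quadForm_le_lambdaMax_mul hSH (EuclideanSpace.single j 1)
    simpa [quadForm] using this
  have htol : hi / (2 * ((m : ℝ) - 1)) ≤ τ := by
    have h1 : hi / (2 * ((m : ℝ) - 1)) ≤ hi / (2 * (s * (hi / lo))) :=
      div_le_div_of_nonneg_left hhi0.le (by positivity) (by linarith)
    refine h1.trans (le_of_eq ?_)
    rw [hτ, ha]
    field_simp
  have hXm : ∀ t, Measurable (X t) := fun t => by
    have : X t = fun ω => (Z t ω).1 := by ext1 ω; simp [hZ]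
    rw [this]
    exact (hmeas t).fst
  set bad : Set Ω := {ω | ∃ J : Fin m → Fin p × Bool, quadForm Sg (signedSum J) / 4 <
    |quadForm (sampleCov X T ω) (signedSum J) - quadForm Sg (signedSum J)|} with hbad
  have hbadm : MeasurableSet bad := measurableSet_exists_signedSum hXm T m Sg
  have hη' : η = 1 / (108 * Real.pi * S * (hi / lo)) := by
    rw [hη]; field_simp
  have hbadP : μ.real bad ≤ 2 * Real.exp (-(1 / 10 / 2) * T * ε) :=
    (measureReal_exists_signedSum_deviation_le hZ hmeas hstat hcent hgauss hT0 hpos m).trans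
      (entropy_le hp hS1 hκ hη' hε0.le (min_le_right _ _) hs1 hs2 hm2)
  have hgood : badᶜ ⊆ {ω | LowerRE (sampleCov X T ω) a τ ∧
      ∀ v : EuclideanSpace ℝ (Fin p), v ≠ 0 →
        a * ‖v‖ ^ 2 - τ * l1norm v ^ 2 < |quadForm (sampleCov X T ω) v|} := by
    intro ω hω
    have hω' : ∀ J : Fin m → Fin p × Bool,
        |quadForm (sampleCov X T ω) (signedSum J) - quadForm Sg (signedSum J)|
          ≤ quadForm Sg (signedSum J) / 4 := fun J => by
      by_contra! h
      exact hω ⟨J, h⟩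
    -- The curvature obtained is `(3/4) λ_min = (3/2) a`; the surplus `a/2` yields the strict
    -- inequality for `v ≠ 0`.
    have hmain : ∀ v : EuclideanSpace ℝ (Fin p),
        3 / 2 * a * ‖v‖ ^ 2 - τ * l1norm v ^ 2 ≤ quadForm (sampleCov X T ω) v := fun v => by
      have h1 := quadForm_lower_bound_of_signedSum hm3 (sampleCov_isSymm X T ω) hSs hdiag hω' v
      have h2 := lambdaMin_mul_le_quadForm hSH v
      have h3 := mul_le_mul_of_nonneg_right htol (sq_nonneg (l1norm v))
      rw [ha]
      linarith
    have ha0 : 0 < a := by rw [ha]; positivity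
    refine ⟨⟨sampleCov_isSymm X T ω, ha0, hτ0, fun v => ?_⟩, fun v hv => ?_⟩
    · have := mul_nonneg ha0.le (sq_nonneg ‖v‖)
      linarith [hmain v]
    · have : 0 < a * ‖v‖ ^ 2 := by have := norm_pos_iff.mpr hv; positivity
      exact lt_of_lt_of_le (by linarith [hmain v]) (le_abs_self _)
  calc 1 - 2 * Real.exp (-(1 / 10 / 2) * T * ε) ≤ 1 - μ.real bad := by linarith
    _ = μ.real badᶜ := (probReal_compl_eq_one_sub hbadm).symm
    _ ≤ _ := measureReal_mono hgood
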